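/- Let $\Gamma$ be a connected loopless graph with at least one edge (multiple edges allowed), 2-cell embedded in a closed surface, with $e=|E(\Gamma)|$ edges and Euler characteristic $\chi=|V(\Gamma)|-|E(\Gamma)|+|F(\Gamma)|$, and suppose that every vertex of $\Gamma$ has even degree greater than $2$. Let $\delta=1$ if the dual graph $\Gamma^*$ is bipartite and $\delta=0$ otherwise. Let $\Gamma_m$ be the medial graph of $\Gamma$ (a vertex on each edge of $\Gamma$, an edge for each corner of $\Gamma$) and $\Gamma_m^*$ its dual, whose vertices correspond to the vertices and the faces of $\Gamma$. Let $\Gamma_2$ be the 2-colex (cubic 3-face-coloured embedded graph) obtained from $\Gamma_m^*$ by splitting every edge, so that it becomes a 4-sided face (an $e$-face), and expanding every vertex of degree $m$ into a $2m$-sided face (a $v$-face); the faces of $\Gamma_m^*$ become the $f$-faces. Let $\mathrm F_v$ be the set of those $v$-faces that come from the vertices of $\Gamma$. Form a hypergraph $\Gamma_h$ from $\Gamma_2$ as follows. Inside every face $f\in\mathrm F_v$ insert a face $f'$ with half as many sides; promote the alternating boundary edges of $f$ that are not on the boundaries of $e$-faces to rank-3 edges, by adding to each of them one vertex of $f'$,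 in the cyclic order of $f$. All edges of $\Gamma_2$ that are not promoted, and the edges of the faces $f'$, are rank-2 edges of $\Gamma_h$. Then $\Gamma_h$ has a proper 3-edge-colouring by the Pauli matrices $X,Y,Z$ in which all rank-3 edges have colour $Z$. For every such colouring place a qubit on each vertex of $\Gamma_h$. Let $K_a$, for an edge $a$, be the product of the Pauli matrices of the colour of $a$ on the vertices of $a$, and let $\mathcal G$ be the group generated by the phases, the operators $K_a$ of all rank-2 edges $a$, and the operators $Z_uZ_w$ for all pairs $u\ne w$ of vertices of a common rank-3 edge. Then $\mathcal G$ is the gauge group of a subsystem code with parameters $$[[\,10e,\; 1-\chi+\delta,\; 6e-\chi,\; d\,]].$$ Here $[[n,k,r,d]]$ means that there are $n$ qubits and that, for some $s$, modulo phases the stabilizer $S=Z(\mathcal G)$ has dimension $s$, $\mathcal G$ has dimension $2r+s$, its centralizer $C(\mathcal G)$ in the Pauli group has dimension $2k+s$, with $n=k+r+s$; and $d$ is the minimum weight of an element of $C(S)\setminus\mathcal G$ ($d=\infty$ if there is none). Moreover $d\le \ell$ whenever $\ell$ is the number of rank-3 edges in a hypercycle $\sigma$ of $\Gamma_h$ (a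 set of edges meeting every vertex an even number of times) whose cycle operator $W(\sigma)=\prod_{a\in\sigma}K_a$ is not in $S$. -/

import Mathlib

/-! ## Graphs that are 2-cell embedded in a closed surface -/

/-- A connected graph 2-cell embedded in a closed surface (orientable or not), described by its
flags.  A flag is a mutually incident triple (vertex-end, edge, side of the edge); `α 0`, `α 1`,
`α 2` send a flag to the flag that differs from it exactly in the vertex, the edge, the face.
Loops and multiple edges are allowed here. -/
structure SurfaceMap (Φ : Type*) where
  α : Fin 3 → Φ → Φ
  involutive : ∀ i, Function.Involutive (α i)
  no_fixed : ∀ i x, α i x ≠ x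
  comm : ∀ x, α 0 (α 2 x) = α 2 (α 0 x)
  no_fixed_edge : ∀ x, α 0 (α 2 x) ≠ x
  connected : ∀ x y, Relation.ReflTransGen (fun a b => ∃ i, b = α i a) x y

namespace SurfaceMap

variable {Φ : Type*} (M : SurfaceMap Φ)

/-- The cells of dimension `i`: orbits of flags under the two involutions that do not change the
`i`-cell. -/
def Cell (i : Fin 3) : Type _ := Quot fun x y : Φ => ∃ j, j ≠ i ∧ y = M.α j x

/-- The `i`-cell of a flag. -/
def cell (i : Fin 3) (x : Φ) : M.Cell i := Quot.mk _ x

abbrev Vertex : Type _ := M.Cell 0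
abbrev Edge : Type _ := M.Cell 1
abbrev Face : Type _ := M.Cell 2

/-- The ends of edges (half-edges): each consists of the two flags on the two sides of an edge at
one of its ends. -/
def EdgeEnd : Type _ := Quot fun x y : Φ => y = M.α 2 x

/-- The half-edge of a flag. -/
def edgeEnd (x : Φ) : M.EdgeEnd := Quot.mk _ x

/-- The degree of a vertex: the number of half-edges at it (a loop counts twice). -/
noncomputable def degree (v : M.Vertex) : ℕ := (M.edgeEnd '' {x | M.cell 0 x = v}).ncard

/-- No edge joins a vertex to itself. -/
def Loopless : Prop := ∀ x, M.cell 0 (M.α 0 x) ≠ M.cell 0 x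

/-- The graph is bipartite: its vertices have a 2-colouring in which the ends of every edge have
different colours. -/
def IsBipartite : Prop :=
  ∃ c : M.Vertex → Bool, ∀ x, c (M.cell 0 (M.α 0 x)) ≠ c (M.cell 0 x)

noncomputable def numEdges : ℕ := Nat.card M.Edge

/-- The Euler characteristic `|V| - |E| + |F|`. -/
noncomputable def eulerChar : ℤ :=
  (Nat.card M.Vertex : ℤ) - (Nat.card M.Edge : ℤ) + (Nat.card M.Face : ℤ)

/-- The dual embedded graph: vertices and faces are exchanged. -/
def dual : SurfaceMap Φ where
  α i := M.α i.rev
  involutive i := M.involutive i.rev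
  no_fixed i := M.no_fixed i.rev
  comm x := (M.comm x).symm
  no_fixed_edge x := by
    intro h
    exact M.no_fixed_edge x ((M.comm x).trans h)
  connected x y := by
    have h := M.connected x y
    induction h with
    | refl => exact Relation.ReflTransGen.refl
    | @tail b c _ hbc ih =>
      obtain ⟨i, h⟩ := hbc
      exact ih.tail ⟨i.rev, by simpa using h⟩

/-- The three flag involutions of the medial graph. -/
def medialFlip : Fin 3 → Φ × Bool → Φ × Bool :=
  ![fun x => (M.α 1 x.1, x.2),
    fun x => (if x.2 then M.α 2 x.1 else M.α 0 x.1, x.2),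
    fun x => (x.1, !x.2)]

/-- The medial graph, with its embedding.  It has a vertex on every edge of `M`, an edge for every
corner of `M` (joining the two consecutive edges that form the corner), and a face for every vertex
and for every face of `M`.  The flag `(x, true)` lies on the edge and the corner of `x` and in the
face that belongs to the vertex of `x`; the flag `(x, false)` lies on the same edge and corner and
in the face that belongs to the face of `x`. -/
def medial : SurfaceMap (Φ × Bool) where
  α := M.medialFlip
  involutive i := by
    have h := M.involutive
    rintro ⟨x, t⟩
    fin_cases i <;> cases t <;> simp [medialFlip, (h _) x]
  no_fixed i := by
    have h := M.no_fixed
    rintro ⟨x, t⟩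
    fin_cases i <;> cases t <;> simp [medialFlip, h]
  comm := by
    rintro ⟨x, t⟩
    simp [medialFlip]
  no_fixed_edge := by
    rintro ⟨x, t⟩
    cases t <;> simp [medialFlip]
  connected := by
    have flip : ∀ (x : Φ) (s t : Bool), Relation.ReflTransGen
        (fun a b => ∃ i, b = M.medialFlip i a) (x, s) (x, t) := by
      intro x s t
      by_cases hst : s = t
      · rw [hst]
      · refine Relation.ReflTransGen.single ⟨2, ?_⟩
        cases s <;> cases t <;> simp_all [medialFlip]
    rintro ⟨x, s⟩ ⟨y, t⟩
    have main : Relation.ReflTransGen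
        (fun a b => ∃ i, b = M.medialFlip i a) (x, s) (y, s) := by
      induction M.connected x y with
      | refl => exact Relation.ReflTransGen.refl
      | @tail b c _ hbc ih =>
        obtain ⟨i, rfl⟩ := hbc
        refine ih.trans ?_
        fin_cases i
        · exact (flip b s false).trans
            (Relation.ReflTransGen.head ⟨1, by simp [medialFlip]⟩ (flip _ false s))
        · exact Relation.ReflTransGen.single ⟨0, by simp [medialFlip]⟩
        · exact (flip b s true).trans
            (Relation.ReflTransGen.head ⟨1, by simp [medialFlip]⟩ (flip _ true s))
    exact main.trans (flip y s t)

end SurfaceMap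

/-! ## 2-colexes -/

/-- A 2-colex: a cubic graph embedded in a closed surface whose faces are properly 3-coloured.  An
edge gets the colour of the two faces that it does not bound; every vertex then has one edge of each
colour, `β c x` is the neighbour of `x` along its edge of colour `c`, and the faces of colour `c` are
the cycles formed by the edges of the two other colours. -/
structure TwoColex (W : Type*) where
  β : Fin 3 → W → W
  involutive : ∀ c, Function.Involutive (β c)
  no_fixed : ∀ c x, β c x ≠ x

namespace TwoColex

variable {W : Type*} (X : TwoColex W)

/-- The faces of colour `c`. -/
def Face (c : Fin 3) : Type _ := Quot fun x y : W => ∃ j, j ≠ c ∧ y = X.β j x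

/-- The face of colour `c` on whose boundary `x` lies. -/
def face (c : Fin 3) (x : W) : X.Face c := Quot.mk _ x

/-- The edges of colour `c`. -/
def Edge (c : Fin 3) : Type _ := Quot fun x y : W => y = X.β c x

/-- The edge of colour `c` at `x`. -/
def edge (c : Fin 3) (x : W) : X.Edge c := Quot.mk _ x

end TwoColex

/-- The 2-colex of an embedded graph: every edge is split and becomes a 4-sided face, every vertex
of degree `d` becomes a face with `2 d` sides, every face with `d` sides becomes a face with `2 d`
sides.  Thus its vertices are the flags, two of them being adjacent if they differ in one component.
The faces of colour `0`, `1`, `2` are the faces that come from vertices (`v`-faces), edges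
(`e`-faces) and faces (`f`-faces). -/
def SurfaceMap.toColex {Φ : Type*} (M : SurfaceMap Φ) : TwoColex Φ where
  β := M.α
  involutive := M.involutive
  no_fixed := M.no_fixed

/-! ## The insertion of rank-3 edges into a 2-colex -/

namespace TwoColex

variable {W : Type*} (X : TwoColex W)

/-- The vertices after rank-3 edges have been inserted in the faces of colour `r` that belong to
`F`, by promoting the edges of colour `p ≠ r` on their boundaries: the old vertices, and one new
vertex for each promoted edge.  The new vertices in a face `f ∈ F` are the vertices of the inner
face of `f`, which has half as many sides. -/
abbrev PromotedVertex (r p : Fin 3) (F : Set (X.Face r)) : Type _ :=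
  W ⊕ {ε : X.Edge p // ∃ x, X.face r x ∈ F ∧ X.edge p x = ε}

/-- The new vertex that belongs to the promoted edge at `x`. -/
def newVertex (r p : Fin 3) (F : Set (X.Face r)) (x : W) (hx : X.face r x ∈ F) :
    X.PromotedVertex r p F :=
  Sum.inr ⟨X.edge p x, x, hx, rfl⟩

/-- The hypergraph obtained by inserting rank-3 edges in the faces of colour `r` that belong to `F`,
promoting the edges of colour `p` on their boundaries.  Its edges are the edges of the 2-colex that
are not promoted, the promoted edges, each with its new vertex added, and the edges of the inner
faces: two new vertices in a face of `F` are joined if their promoted edges are consecutive, that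
is, linked by one boundary edge of the third colour `q`. -/
def promote (r p : Fin 3) (F : Set (X.Face r)) : Hypergraph (X.PromotedVertex r p F) where
  vertexSet := Set.univ
  edgeSet :=
    {e | ∃ (c : Fin 3) (x : W), ¬ (c = p ∧ X.face r x ∈ F) ∧
        e = {Sum.inl x, Sum.inl (X.β c x)}} ∪
    {e | ∃ (x : W) (hx : X.face r x ∈ F),
        e = {Sum.inl x, Sum.inl (X.β p x), X.newVertex r p F x hx}} ∪
    {e | ∃ (q : Fin 3) (x : W) (hx : X.face r x ∈ F) (hy : X.face r (X.β q x) ∈ F),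
        q ≠ r ∧ q ≠ p ∧
        e = {X.newVertex r p F x hx, X.newVertex r p F (X.β q x) hy}}
  subset_vertexSet_of_mem_edgeSet' _ _ := Set.subset_univ _

end TwoColex

/-! ## The Pauli group and subsystem codes -/

/-- The three Pauli matrices. -/
inductive PauliLetter
  | X
  | Y
  | Z

/-- The elements of the Pauli group on qubits indexed by `V`: the triple `(p, x, z)` stands for the
operator `i ^ p · ∏ v, X_v ^ x v · ∏ v, Z_v ^ z v`. -/
@[ext]
structure Pauli (V : Type*) where
  phase : ZMod 4
  x : V → ZMod 2
  z : V → ZMod 2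

namespace Pauli

variable {V : Type*}

theorem vec_add_self (a : V → ZMod 2) : a + a = 0 := by
  funext v
  exact CharTwo.add_self_eq_zero (a v)

instance : One (Pauli V) := ⟨⟨0, 0, 0⟩⟩

theorem one_def : (1 : Pauli V) = ⟨0, 0, 0⟩ := rfl

variable [Fintype V]

/-- The exponent of `i` in the sign `(-1) ^ ∑ v, a v * b v`. -/
def signExp (a b : V → ZMod 2) : ZMod 4 := 2 * ((∑ v, a v * b v).val : ZMod 4)

theorem two_mul_val_add (a b : ZMod 2) :
    2 * ((a + b).val : ZMod 4) = 2 * (a.val : ZMod 4) + 2 * (b.val : ZMod 4) := by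
  revert a b
  decide

theorem signExp_add_left (a a' b : V → ZMod 2) :
    signExp (a + a') b = signExp a b + signExp a' b := by
  simp only [signExp, Pi.add_apply, add_mul, Finset.sum_add_distrib, two_mul_val_add]

theorem signExp_add_right (a b b' : V → ZMod 2) :
    signExp a (b + b') = signExp a b + signExp a b' := by
  simp only [signExp, Pi.add_apply, mul_add, Finset.sum_add_distrib, two_mul_val_add]

theorem signExp_zero_left (b : V → ZMod 2) : signExp 0 b = 0 := by
  simp [signExp]

theorem signExp_zero_right (a : V → ZMod 2) : signExp a 0 = 0 := by
  simp [signExp]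

/-- The multiplication of operators, which follows from `Z_v X_v = - X_v Z_v`. -/
instance : Mul (Pauli V) :=
  ⟨fun g h => ⟨g.phase + h.phase + signExp g.z h.x, g.x + h.x, g.z + h.z⟩⟩

instance : Inv (Pauli V) := ⟨fun g => ⟨-g.phase - signExp g.z g.x, g.x, g.z⟩⟩

theorem mul_def (g h : Pauli V) :
    g * h = ⟨g.phase + h.phase + signExp g.z h.x, g.x + h.x, g.z + h.z⟩ := rfl

theorem inv_def (g : Pauli V) : g⁻¹ = ⟨-g.phase - signExp g.z g.x, g.x, g.z⟩ := rfl

instance : Group (Pauli V) :=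
  Group.ofLeftAxioms
    (by
      intro g h k
      simp only [mul_def, signExp_add_left, signExp_add_right, mk.injEq]
      exact ⟨by ring, add_assoc _ _ _, add_assoc _ _ _⟩)
    (by
      intro g
      simp [mul_def, one_def, signExp_zero_left])
    (by
      intro g
      simp only [mul_def, one_def, inv_def, mk.injEq]
      exact ⟨by ring, vec_add_self _, vec_add_self _⟩)

/-- The operator that acts as the given Pauli matrix on every qubit of `e` (and as the identity on
the other qubits); `Y = i X Z`. -/
noncomputable def on (e : Set V) : PauliLetter → Pauli V
  | .X => ⟨0, e.indicator 1, 0⟩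
  | .Y => ⟨(e.ncard : ZMod 4), e.indicator 1, e.indicator 1⟩
  | .Z => ⟨0, 0, e.indicator 1⟩

/-- The weight: the number of qubits on which the operator acts nontrivially. -/
noncomputable def weight (g : Pauli V) : ℕ := {v | g.x v ≠ 0 ∨ g.z v ≠ 0}.ncard

variable (V) in
/-- The phases `i ^ p`. -/
def phases : Subgroup (Pauli V) where
  carrier := {g | g.x = 0 ∧ g.z = 0}
  one_mem' := ⟨rfl, rfl⟩
  mul_mem' := by
    rintro g h ⟨h1, h2⟩ ⟨h3, h4⟩
    exact ⟨by simp [mul_def, h1, h3], by simp [mul_def, h2, h4]⟩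
  inv_mem' := by
    rintro g ⟨h1, h2⟩
    exact ⟨h1, h2⟩

/-- Modulo phases, the subgroup `H` has `m` independent generators. -/
def HasDim (H : Subgroup (Pauli V)) (m : ℕ) : Prop := (phases V).relIndex H = 2 ^ m

/-- The stabilizer (with phases) of the subsystem code with gauge group `G`: the centre of `G`. -/
def stabilizer (G : Subgroup (Pauli V)) : Subgroup (Pauli V) :=
  (Subgroup.center G).map G.subtype

/-- The distance: the least weight of a dressed logical operator that is not in the gauge group
(`⊤` if there is none, which happens exactly if no qubit is encoded). -/
noncomputable def distance (G : Subgroup (Pauli V)) : ℕ∞ :=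
  ⨅ g : {g : Pauli V // g ∈ Subgroup.centralizer (stabilizer G : Set (Pauli V)) ∧ g ∉ G},
    (g.1.weight : ℕ∞)

/-- The gauge group `G` (a subgroup of the Pauli group that contains the phases) defines an
`[[n, k, r, d]]` subsystem code: `n` physical, `k` encoded and `r` gauge qubits, distance `d`. -/
def IsSubsystemCode (G : Subgroup (Pauli V)) (n k r : ℕ) (d : ℕ∞) : Prop :=
  phases V ≤ G ∧ n = Nat.card V ∧ d = distance G ∧
    ∃ s : ℕ, n = k + r + s ∧ HasDim (stabilizer G) s ∧ HasDim G (2 * r + s) ∧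
      HasDim (Subgroup.centralizer (G : Set (Pauli V))) (2 * k + s)

end Pauli

/-! ## The subsystem code of a hypergraph -/

/-- A 3-edge-colouring by Pauli matrices in which all rank-3 edges get the colour `Z`. -/
def Hypergraph.IsEdgeColoring {V : Type*} (H : Hypergraph V) (c : Set V → PauliLetter) : Prop :=
  (∀ e ∈ H.edgeSet, e.ncard = 3 → c e = .Z) ∧
    ∀ e ∈ H.edgeSet, ∀ e' ∈ H.edgeSet, e ≠ e' → (e ∩ e').Nonempty → c e ≠ c e'

/-- A hypercycle: a set of edges such that every vertex is on an even number of them. -/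
def Hypergraph.IsHypercycle {V : Type*} (H : Hypergraph V) (σ : Finset (Set V)) : Prop :=
  (∀ e ∈ σ, e ∈ H.edgeSet) ∧ ∀ v, Even {e | e ∈ σ ∧ v ∈ e}.ncard

/-- The gauge group, with one qubit for every element of `V`: it is generated, with
the phases, by the link operators of the rank-2 edges and, for each rank-3 edge, the operators
`Z_u Z_v` on the pairs of its vertices. -/
def Hypergraph.gaugeGroup {V : Type*} [Fintype V] (H : Hypergraph V)
    (c : Set V → PauliLetter) : Subgroup (Pauli V) :=
  Subgroup.closure
    ({g | ∃ e ∈ H.edgeSet, e.ncard = 2 ∧ g = Pauli.on e (c e)} ∪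
      {g | ∃ e ∈ H.edgeSet, e.ncard = 3 ∧ ∃ u ∈ e, ∃ v ∈ e, u ≠ v ∧ g = Pauli.on {u, v} .Z}) ⊔
    Pauli.phases V

/-- The cycle operator `W(σ)`: the product of the link operators of the edges of `σ`.  (The order of
the factors only affects the sign.) -/
noncomputable def cycleOperator {V : Type*} [Fintype V] (c : Set V → PauliLetter)
    (σ : Finset (Set V)) : Pauli V :=
  (σ.toList.map fun e => Pauli.on e (c e)).prod

/-- The number of rank-3 edges in `σ`. -/
noncomputable def numRankThree {V : Type*} (σ : Finset (Set V)) : ℕ :=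
  {e | e ∈ σ ∧ e.ncard = 3}.ncard

/-! ## The codes from medial graphs -/

namespace SurfaceMap

variable {Φ : Type*} (M : SurfaceMap Φ)

/-- The 2-colex built from the dual of the medial graph. -/
def medialColex : TwoColex (Φ × Bool) := M.medial.dual.toColex

/-- The class of those `v`-faces of the 2-colex that come from the vertices of the graph (the other
`v`-faces come from its faces). -/
def vertexFaces : Set (M.medialColex.Face 0) := {f | ∃ x : Φ, M.medialColex.face 0 (x, true) = f}

/-- The vertices of the hypergraph `M.medialHypergraph`. -/
abbrev MedialHVertex : Type _ := M.medialColex.PromotedVertex 0 1 M.vertexFaces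

/-- Rank-3 edges are inserted in the `v`-faces of the class `vertexFaces`.  The promoted edges have
colour `1`, the colour of the `e`-faces, so they are not on the boundaries of `e`-faces. -/
def medialHypergraph : Hypergraph M.MedialHVertex :=
  M.medialColex.promote 0 1 M.vertexFaces

instance [Finite Φ] : Finite M.MedialHVertex :=
  haveI : Finite (M.medialColex.Edge 1) := Quot.finite _
  inferInstance

noncomputable instance [Finite Φ] : Fintype M.MedialHVertex := Fintype.ofFinite _

open Classical in
/-- `1` if the dual graph is bipartite, and `0` otherwise. -/
noncomputable def dualBipartiteDelta : ℕ := if M.dual.IsBipartite then 1 else 0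

end SurfaceMap

/-!
Modulo phases, the Pauli group is a vector space over `ZMod 2` with a symplectic form, in which two
operators commute if and only if their vectors are orthogonal.  The gauge group is the preimage of a
subspace `N` (`Hypergraph.gaugeSpace`), its centralizer is the preimage of the orthogonal complement
of `N`, and the stabilizer that of `N ⊓ Nᗮ`.  So the parameters of the code follow from the
dimensions of `N` and of `N ⊓ Nᗮ` (`Pauli.isSubsystemCode_ofSubspace`).

The gauge group has `16 e` generators: the `12 e` rank-2 edges, and for each of the `2 e` rank-3
edges the two operators that join its old vertices to its inner vertex.  At every vertex of the hypergraph
three edges of different colours meet, so a product of generators is trivial there if and only if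
the three exponents agree.  Hence a relation between the generators is a function `s` on the faces
of the graph with `s + s' = t` for the two faces at each edge, where `t` is a constant.  Such
relations form a space of dimension `1 + δ` (`SurfaceMap.finrank_ker_gaugeMap`), and the dimension of
the gauge group is `16 e - 1 - δ`, whatever the colouring is.

A product of generators is in the centre if and only if it satisfies the commutation relations with
all generators, which are linear equations in the exponents
(`SurfaceMap.gaugeMap_mem_orthogonal_iff`).  They are solved explicitly
(`SurfaceMap.range_centreMap`): the solutions are parametrized by two functions on vertices, two
functions on faces and a function on corners.  The even degrees enter through a function on corners
that alternates around each vertex (`SurfaceMap.exists_alternating`); the same function gives the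
colouring of the inner faces.  As all relations are among the solutions, the dimension of the
stabilizer is `2 |V| + 2 |F| + 2 e - 1 - δ`
(`SurfaceMap.finrank_gaugeSpace_inf_orthogonal`).

For the distance, the cycle operator of a hypercycle commutes with the gauge group.  Modulo the
gauge group its rank-2 factors are trivial and each rank-3 factor `ZZZ` is a single `Z`, which leaves a
dressed logical operator whose weight is at most the number of rank-3 edges
(`Hypergraph.distance_le_numRankThree`).
-/

/-! ### The Pauli group as a symplectic space -/

/-- The binary vector `(x, z)` of a Pauli matrix. -/
def PauliLetter.vec : PauliLetter → ZMod 2 × ZMod 2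
  | .X => (1, 0)
  | .Y => (1, 1)
  | .Z => (0, 1)

theorem PauliLetter.smul_add_smul_add_smul_eq_zero {K L M : PauliLetter} (hKL : K ≠ L)
    (hKM : K ≠ M) (hLM : L ≠ M) {a b c : ZMod 2} :
    a • K.vec + b • L.vec + c • M.vec = 0 ↔ a = b ∧ b = c := by
  revert a b c
  cases K <;> cases L <;> cases M <;> first | contradiction | (simp only [vec]; decide)

namespace Pauli

/-- The symplectic form of a single qubit: it vanishes if and only if the two Pauli operators
commute. -/
def qubitForm (a b : ZMod 2 × ZMod 2) : ZMod 2 := a.1 * b.2 + a.2 * b.1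

theorem qubitForm_add_left (a b c : ZMod 2 × ZMod 2) :
    qubitForm (a + b) c = qubitForm a c + qubitForm b c := by
  simp only [qubitForm, Prod.fst_add, Prod.snd_add]; ring

theorem qubitForm_add_right (a b c : ZMod 2 × ZMod 2) :
    qubitForm a (b + c) = qubitForm a b + qubitForm a c := by
  simp only [qubitForm, Prod.fst_add, Prod.snd_add]; ring

theorem qubitForm_smul_left (t : ZMod 2) (a b : ZMod 2 × ZMod 2) :
    qubitForm (t • a) b = t * qubitForm a b := by
  simp only [qubitForm, Prod.smul_fst, Prod.smul_snd, smul_eq_mul]; ring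

theorem qubitForm_smul_right (t : ZMod 2) (a b : ZMod 2 × ZMod 2) :
    qubitForm a (t • b) = t * qubitForm a b := by
  simp only [qubitForm, Prod.smul_fst, Prod.smul_snd, smul_eq_mul]; ring

theorem qubitForm_comm (a b : ZMod 2 × ZMod 2) : qubitForm a b = qubitForm b a := by
  simp only [qubitForm]; ring

theorem qubitForm_zero_left (a : ZMod 2 × ZMod 2) : qubitForm 0 a = 0 := by simp [qubitForm]

theorem qubitForm_zero_right (a : ZMod 2 × ZMod 2) : qubitForm a 0 = 0 := by simp [qubitForm]

theorem qubitForm_self (a : ZMod 2 × ZMod 2) : qubitForm a a = 0 := by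
  simp only [qubitForm, mul_comm a.2, CharTwo.add_self_eq_zero]

theorem qubitForm_vec_of_ne {K L : PauliLetter} (h : K ≠ L) : qubitForm K.vec L.vec = 1 := by
  cases K <;> cases L <;> first | contradiction | decide

variable {V : Type*}

/-- The binary vector of an element of the Pauli group: the operator modulo phases. -/
def toVec (g : Pauli V) : V → ZMod 2 × ZMod 2 := fun v => (g.x v, g.z v)

theorem toVec_on (e : Set V) (L : PauliLetter) (v : V) [Decidable (v ∈ e)] :
    toVec (on e L) v = if v ∈ e then L.vec else 0 := by
  cases L <;> by_cases h : v ∈ e <;> simp [toVec, on, h, PauliLetter.vec]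

theorem toVec_surjective (p : V → ZMod 2 × ZMod 2) : ∃ g : Pauli V, toVec g = p :=
  ⟨⟨0, fun v => (p v).1, fun v => (p v).2⟩, rfl⟩

open Classical in
/-- The vector of the operator that acts as `a` on the qubit `u` and trivially elsewhere. -/
noncomputable def site (u : V) (a : ZMod 2 × ZMod 2) : V → ZMod 2 × ZMod 2 := Pi.single u a

theorem site_apply (u : V) (a : ZMod 2 × ZMod 2) (v : V) [Decidable (v = u)] :
    site u a v = if v = u then a else 0 := by
  classical
  rw [site, Pi.single_apply]
  congr

theorem add_self_vec (p : V → ZMod 2 × ZMod 2) : p + p = 0 :=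
  funext fun v => Prod.ext (CharTwo.add_self_eq_zero (p v).1) (CharTwo.add_self_eq_zero (p v).2)

/-- It suffices to compare all vertices of an edge with one fixed vertex. -/
theorem site_add_site_mem_of_star {N : Submodule (ZMod 2) (V → ZMod 2 × ZMod 2)}
    {e : Set V} {n : V} {l : ZMod 2 × ZMod 2} (h : ∀ u ∈ e, site u l + site n l ∈ N) :
    ∀ u ∈ e, ∀ v ∈ e, site u l + site v l ∈ N := by
  intro u hu v hv
  have := N.add_mem (h u hu) (h v hv)
  rwa [add_add_add_comm, add_self_vec, add_zero] at this

theorem site_add_site_mem_of_pair {N : Submodule (ZMod 2) (V → ZMod 2 × ZMod 2)}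
    {a b : V} {l : ZMod 2 × ZMod 2} (h : site a l + site b l ∈ N) :
    ∀ u ∈ ({a, b} : Set V), ∀ v ∈ ({a, b} : Set V), site u l + site v l ∈ N := by
  refine site_add_site_mem_of_star (n := b) ?_
  rintro u (rfl | rfl)
  · exact h
  · rw [add_self_vec]
    exact N.zero_mem

variable [Fintype V]

theorem toVec_mul (g h : Pauli V) : toVec (g * h) = toVec g + toVec h := rfl

theorem toVec_inv (g : Pauli V) : toVec g⁻¹ = toVec g := rfl

theorem mem_phases_iff (g : Pauli V) : g ∈ phases V ↔ toVec g = 0 := by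
  constructor
  · rintro ⟨h1, h2⟩
    funext v
    exact Prod.ext (congrFun h1 v) (congrFun h2 v)
  · intro h
    exact ⟨funext fun v => congrArg Prod.fst (congrFun h v),
      funext fun v => congrArg Prod.snd (congrFun h v)⟩

theorem toVec_list_prod (l : List (Pauli V)) : toVec l.prod = (l.map toVec).sum := by
  induction l with
  | nil => rfl
  | cons a l ih => rw [List.prod_cons, toVec_mul, ih, List.map_cons, List.sum_cons]

variable (V) in
/-- The symplectic form on binary vectors. -/
def form : LinearMap.BilinForm (ZMod 2) (V → ZMod 2 × ZMod 2) :=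
  LinearMap.mk₂ (ZMod 2) (fun p q => ∑ v, qubitForm (p v) (q v))
    (fun p p' q => by simp [qubitForm_add_left, Finset.sum_add_distrib])
    (fun t p q => by simp [qubitForm_smul_left, Finset.mul_sum])
    (fun p q q' => by simp [qubitForm_add_right, Finset.sum_add_distrib])
    (fun t p q => by simp [qubitForm_smul_right, Finset.mul_sum])

theorem form_apply (p q : V → ZMod 2 × ZMod 2) : form V p q = ∑ v, qubitForm (p v) (q v) := rfl

theorem form_comm (p q : V → ZMod 2 × ZMod 2) : form V p q = form V q p := by
  simp only [form_apply, qubitForm_comm]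

theorem form_site (p : V → ZMod 2 × ZMod 2) (u : V) (a : ZMod 2 × ZMod 2) :
    form V p (site u a) = qubitForm (p u) a := by
  classical
  rw [form_apply, Finset.sum_eq_single u]
  · rw [site_apply, if_pos rfl]
  · intro v _ hv
    rw [site_apply, if_neg hv, qubitForm_zero_right]
  · simp

theorem nondegenerate_form : (form V).Nondegenerate := by
  have key : ∀ p : V → ZMod 2 × ZMod 2, (∀ q, form V p q = 0) → p = 0 := by
    intro p h
    funext v
    have h1 := h (site v (0, 1))
    have h2 := h (site v (1, 0))
    rw [form_site] at h1 h2
    simp only [qubitForm, mul_one, mul_zero, add_zero, zero_add] at h1 h2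
    exact Prod.ext h1 h2
  exact ⟨key, fun q h => key q fun p => by rw [form_comm]; exact h p⟩

theorem mul_eq_mul_iff (g h : Pauli V) : g * h = h * g ↔ form V (toVec g) (toVec h) = 0 := by
  have key : ∀ a b : ZMod 2, 2 * (a.val : ZMod 4) = 2 * (b.val : ZMod 4) ↔ b + a = 0 := by decide
  have hf : form V (toVec g) (toVec h) = (∑ v, h.z v * g.x v) + ∑ v, g.z v * h.x v := by
    rw [form_apply, ← Finset.sum_add_distrib]
    exact Finset.sum_congr rfl fun v _ => by simp only [qubitForm, toVec]; ring
  rw [hf, ← key, mul_def, mul_def, mk.injEq, add_comm h.phase, add_comm h.x, add_comm h.z]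
  simp only [and_true, add_right_inj]
  rfl

/-- The operators, with all phases, whose vectors lie in a given subspace. -/
def ofSubspace (N : Submodule (ZMod 2) (V → ZMod 2 × ZMod 2)) : Subgroup (Pauli V) where
  carrier := {g | toVec g ∈ N}
  one_mem' := N.zero_mem
  mul_mem' {_ _} hg hh := N.add_mem hg hh
  inv_mem' {_} hg := hg

theorem mem_ofSubspace {N : Submodule (ZMod 2) (V → ZMod 2 × ZMod 2)} {g : Pauli V} :
    g ∈ ofSubspace N ↔ toVec g ∈ N := Iff.rfl

theorem phases_le_ofSubspace (N : Submodule (ZMod 2) (V → ZMod 2 × ZMod 2)) :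
    phases V ≤ ofSubspace N := fun g hg => by
  rw [mem_ofSubspace, (mem_phases_iff g).1 hg]
  exact N.zero_mem

theorem hasDim_ofSubspace (N : Submodule (ZMod 2) (V → ZMod 2 × ZMod 2)) :
    HasDim (ofSubspace N) (Module.finrank (ZMod 2) N) := by
  let f : ofSubspace N →* Multiplicative N :=
    { toFun := fun g => Multiplicative.ofAdd ⟨toVec g.1, g.2⟩
      map_one' := rfl
      map_mul' := fun _ _ => rfl }
  have hker : f.ker = (phases V).subgroupOf (ofSubspace N) := by
    ext g
    rw [MonoidHom.mem_ker, Subgroup.mem_subgroupOf, mem_phases_iff]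
    exact Subtype.ext_iff (a1 := (⟨toVec g.1, g.2⟩ : N)) (a2 := 0)
  have hsurj : f.range = ⊤ := by
    rw [MonoidHom.range_eq_top]
    rintro ⟨p, hp⟩
    obtain ⟨g, rfl⟩ := toVec_surjective p
    exact ⟨⟨g, hp⟩, rfl⟩
  rw [HasDim, Subgroup.relIndex, ← hker, Subgroup.index_ker, hsurj, Subgroup.card_top]
  calc Nat.card (Multiplicative N) = Nat.card N := rfl
    _ = 2 ^ Module.finrank (ZMod 2) N := by
      rw [Module.natCard_eq_pow_finrank (K := ZMod 2), Nat.card_zmod]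

theorem mem_orthogonal {N : Submodule (ZMod 2) (V → ZMod 2 × ZMod 2)}
    {p : V → ZMod 2 × ZMod 2} : p ∈ (form V).orthogonal N ↔ ∀ q ∈ N, form V p q = 0 := by
  simp only [LinearMap.BilinForm.mem_orthogonal_iff, form_comm p]

theorem centralizer_ofSubspace (N : Submodule (ZMod 2) (V → ZMod 2 × ZMod 2)) :
    Subgroup.centralizer (ofSubspace N : Set (Pauli V)) =
      ofSubspace ((form V).orthogonal N) := by
  ext g
  rw [Subgroup.mem_centralizer_iff, mem_ofSubspace, LinearMap.BilinForm.mem_orthogonal_iff]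
  constructor
  · intro h q hq
    obtain ⟨k, rfl⟩ := toVec_surjective q
    exact (mul_eq_mul_iff k g).1 (h k hq)
  · intro h k hk
    exact (mul_eq_mul_iff k g).2 (h _ hk)

theorem stabilizer_ofSubspace (N : Submodule (ZMod 2) (V → ZMod 2 × ZMod 2)) :
    stabilizer (ofSubspace N) = ofSubspace (N ⊓ (form V).orthogonal N) := by
  ext g
  rw [mem_ofSubspace, Submodule.mem_inf, ← mem_ofSubspace (N := (form V).orthogonal N),
    ← centralizer_ofSubspace, Subgroup.mem_centralizer_iff, stabilizer, Subgroup.mem_map]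
  constructor
  · rintro ⟨k, hk, rfl⟩
    rw [Subgroup.mem_center_iff] at hk
    exact ⟨k.2, fun h hh => congrArg Subtype.val (hk ⟨h, hh⟩)⟩
  · rintro ⟨h1, h2⟩
    exact ⟨⟨g, h1⟩, Subgroup.mem_center_iff.2 fun k => Subtype.ext (h2 k k.2), rfl⟩

/-- The parameters of the subsystem code whose gauge group is given by the subspace `N`. -/
theorem isSubsystemCode_ofSubspace (N : Submodule (ZMod 2) (V → ZMod 2 × ZMod 2))
    {n k r s : ℕ} (hn : n = Nat.card V)
    (hs : Module.finrank (ZMod 2) ↥(N ⊓ (form V).orthogonal N) = s)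
    (hN : Module.finrank (ZMod 2) N = 2 * r + s) (hk : n = k + r + s) :
    IsSubsystemCode (ofSubspace N) n k r (distance (ofSubspace N)) := by
  refine ⟨phases_le_ofSubspace N, hn, rfl, s, hk, ?_, ?_, ?_⟩
  · rw [stabilizer_ofSubspace, ← hs]
    exact hasDim_ofSubspace _
  · rw [← hN]
    exact hasDim_ofSubspace _
  · have h := LinearMap.BilinForm.finrank_orthogonal nondegenerate_form N
    have hV : Module.finrank (ZMod 2) (V → ZMod 2 × ZMod 2) = 2 * n := by
      rw [Module.finrank_pi_fintype]
      simp [hn, mul_comm]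
    rw [hV, hN, show 2 * n - (2 * r + s) = 2 * k + s by omega] at h
    rw [centralizer_ofSubspace, ← h]
    exact hasDim_ofSubspace _

end Pauli

/-! ### The gauge group of a coloured hypergraph -/

namespace Hypergraph

open Pauli

variable {V : Type*} (H : Hypergraph V) (c : Set V → PauliLetter)

/-- The vectors of the operators in the gauge group.  For edges of rank 2 and 3 the generators are
treated alike: they act as the colour of an edge on two of its vertices. -/
def gaugeSpace : Submodule (ZMod 2) (V → ZMod 2 × ZMod 2) :=
  Submodule.span (ZMod 2)
    {p | ∃ e ∈ H.edgeSet, ∃ u ∈ e, ∃ v ∈ e, p = site u (c e).vec + site v (c e).vec}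

variable {H c}

theorem toVec_on_pair {u v : V} (h : u ≠ v) (L : PauliLetter) :
    toVec (on {u, v} L) = site u L.vec + site v L.vec := by
  classical
  funext w
  rw [toVec_on, Pi.add_apply, site_apply, site_apply]
  by_cases h1 : w = u
  · subst h1
    simp [h]
  · by_cases h2 : w = v
    · subst h2
      simp [h1]
    · simp [h1, h2]

theorem site_add_site_mem_gaugeSpace {e : Set V} (he : e ∈ H.edgeSet) {u v : V} (hu : u ∈ e)
    (hv : v ∈ e) : site u (c e).vec + site v (c e).vec ∈ H.gaugeSpace c :=
  Submodule.subset_span ⟨e, he, u, hu, v, hv, rfl⟩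

variable [Fintype V]

theorem gaugeGroup_eq_ofSubspace (hrank : ∀ e ∈ H.edgeSet, e.ncard = 2 ∨ e.ncard = 3)
    (hc : H.IsEdgeColoring c) : H.gaugeGroup c = ofSubspace (H.gaugeSpace c) := by
  apply le_antisymm
  · refine sup_le ((Subgroup.closure_le _).2 ?_) (phases_le_ofSubspace _)
    rintro g (⟨e, he, h2, rfl⟩ | ⟨e, he, h3, u, hu, v, hv, huv, rfl⟩)
    · obtain ⟨u, v, huv, rfl⟩ := Set.ncard_eq_two.1 h2
      rw [SetLike.mem_coe, mem_ofSubspace, toVec_on_pair huv]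
      exact site_add_site_mem_gaugeSpace he (by simp) (by simp)
    · rw [SetLike.mem_coe, mem_ofSubspace, toVec_on_pair huv, ← hc.1 e he h3]
      exact site_add_site_mem_gaugeSpace he hu hv
  · have key : ∀ p ∈ H.gaugeSpace c, ∀ g : Pauli V, toVec g = p → g ∈ H.gaugeGroup c := by
      have hphase : ∀ g h : Pauli V, toVec g = toVec h → h ∈ H.gaugeGroup c →
          g ∈ H.gaugeGroup c := by
        intro g h hgh hh
        have : g * h⁻¹ ∈ H.gaugeGroup c := by
          refine Subgroup.mem_sup_right ((mem_phases_iff _).2 ?_)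
          rw [toVec_mul, toVec_inv, hgh, add_self_vec]
        simpa using mul_mem this hh
      intro p hp
      induction hp using Submodule.span_induction with
      | mem p hp =>
        obtain ⟨e, he, u, hu, v, hv, rfl⟩ := hp
        intro g hg
        by_cases huv : u = v
        · subst huv
          refine Subgroup.mem_sup_right ((mem_phases_iff _).2 ?_)
          rw [hg, add_self_vec]
        · rw [← toVec_on_pair huv] at hg
          refine hphase _ _ hg (Subgroup.mem_sup_left (Subgroup.subset_closure ?_))
          rcases hrank e he with h2 | h3
          · refine Or.inl ⟨e, he, h2, ?_⟩
            have : ({u, v} : Set V) = e := by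
              refine Set.eq_of_subset_of_ncard_le (by
                rintro w (rfl | rfl) <;> assumption) ?_
              rw [h2, Set.ncard_pair huv]
            rw [this]
          · exact Or.inr ⟨e, he, h3, u, hu, v, hv, huv, by rw [hc.1 e he h3]⟩
      | zero => exact fun g hg => Subgroup.mem_sup_right ((mem_phases_iff _).2 hg)
      | add p q _ _ hp hq =>
        intro g hg
        obtain ⟨k, rfl⟩ := toVec_surjective p
        obtain ⟨l, rfl⟩ := toVec_surjective q
        exact hphase g (k * l) hg (mul_mem (hp k rfl) (hq l rfl))
      | smul t p _ hp =>
        intro g hg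
        have ht : ∀ t : ZMod 2, t = 0 ∨ t = 1 := by decide
        rcases ht t with rfl | rfl
        · exact Subgroup.mem_sup_right ((mem_phases_iff _).2 (by rw [hg, zero_smul]))
        · exact hp g (by rw [hg, one_smul])
    exact fun g hg => key _ hg g rfl

/-- An operator commutes with the gauge group if and only if, for every edge, it either commutes
with the colour of the edge at all vertices of the edge or anticommutes at all of them. -/
theorem mem_orthogonal_gaugeSpace {p : V → ZMod 2 × ZMod 2} :
    p ∈ (form V).orthogonal (H.gaugeSpace c) ↔ ∀ e ∈ H.edgeSet, ∀ u ∈ e, ∀ v ∈ e,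
      qubitForm (p u) (c e).vec = qubitForm (p v) (c e).vec := by
  rw [mem_orthogonal]
  constructor
  · intro h e he u hu v hv
    have := h _ (site_add_site_mem_gaugeSpace he hu hv)
    rwa [map_add, form_site, form_site, CharTwo.add_eq_zero] at this
  · intro h q hq
    induction hq using Submodule.span_induction with
    | mem q hq =>
      obtain ⟨e, he, u, hu, v, hv, rfl⟩ := hq
      rw [map_add, form_site, form_site, CharTwo.add_eq_zero]
      exact h e he u hu v hv
    | zero => exact map_zero _
    | add p q _ _ hp hq => rw [map_add, hp, hq, add_zero]
    | smul t p _ hp => rw [map_smul, hp, smul_zero]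

theorem toVec_cycleOperator (σ : Finset (Set V)) :
    toVec (cycleOperator c σ) = ∑ e ∈ σ, toVec (on e (c e)) := by
  rw [cycleOperator, toVec_list_prod, List.map_map, Finset.sum_map_toList]
  rfl

/-- Cycle operators of hypercycles commute with the gauge group. -/
theorem toVec_cycleOperator_mem_orthogonal (hc : H.IsEdgeColoring c) {σ : Finset (Set V)}
    (hσ : H.IsHypercycle σ) :
    toVec (cycleOperator c σ) ∈ (form V).orthogonal (H.gaugeSpace c) := by
  classical
  rw [mem_orthogonal_gaugeSpace]
  intro a ha
  -- At a vertex of `a`, the factors that anticommute with `a` are those of the other edges of `σ`;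
  -- their number has the parity of `a ∈ σ`.
  suffices h : ∀ v ∈ a, qubitForm (toVec (cycleOperator c σ) v) (c a).vec =
      if a ∈ σ then 1 else 0 from fun u hu v hv => (h u hu).trans (h v hv).symm
  intro v hv
  have hadd : ∀ (s : Finset (Set V)) (f : Set V → ZMod 2 × ZMod 2),
      qubitForm (∑ e ∈ s, f e) (c a).vec = ∑ e ∈ s, qubitForm (f e) (c a).vec := by
    intro s f
    induction s using Finset.induction_on with
    | empty => exact qubitForm_zero_left _
    | insert e s he ih => rw [Finset.sum_insert he, Finset.sum_insert he, qubitForm_add_left, ih]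
  have hterm : ∀ e ∈ σ, qubitForm (toVec (on e (c e)) v) (c a).vec =
      (if v ∈ e then 1 else 0) + if e = a then 1 else 0 := by
    intro e he
    rw [toVec_on]
    by_cases hea : e = a
    · subst hea
      rw [if_pos hv, qubitForm_self, if_pos hv, if_pos rfl]
      rfl
    · rw [if_neg hea, add_zero]
      by_cases hve : v ∈ e
      · rw [if_pos hve, if_pos hve,
          qubitForm_vec_of_ne (hc.2 e (hσ.1 e he) a ha hea ⟨v, hve, hv⟩)]
      · rw [if_neg hve, if_neg hve, qubitForm_zero_left]
  have heven : ∑ e ∈ σ, (if v ∈ e then 1 else 0 : ZMod 2) = 0 := by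
    rw [Finset.sum_boole, ZMod.natCast_eq_zero_iff_even]
    convert hσ.2 v
    rw [← Set.ncard_coe_finset]
    congr 1
    ext e
    simp
  rw [toVec_cycleOperator, Finset.sum_apply, hadd, Finset.sum_congr rfl hterm,
    Finset.sum_add_distrib, heven, zero_add, Finset.sum_ite_eq']

/-- A rank-3 operator acts, modulo the gauge group, on a single qubit; a rank-2 one acts trivially.
So a cycle operator has the weight of its rank-3 edges. -/
theorem distance_le_numRankThree (hrank : ∀ e ∈ H.edgeSet, e.ncard = 2 ∨ e.ncard = 3)
    (hc : H.IsEdgeColoring c) {σ : Finset (Set V)} (hσ : H.IsHypercycle σ)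
    (hS : cycleOperator c σ ∉ stabilizer (H.gaugeGroup c)) :
    distance (H.gaugeGroup c) ≤ numRankThree σ := by
  classical
  set N := H.gaugeSpace c with hN
  rw [gaugeGroup_eq_ofSubspace hrank hc, ← hN] at hS ⊢
  rw [stabilizer_ofSubspace, mem_ofSubspace, Submodule.mem_inf] at hS
  have hW := toVec_cycleOperator_mem_orthogonal hc hσ
  have hWN : toVec (cycleOperator c σ) ∉ N := fun h => hS ⟨h, hW⟩
  -- `q` is what remains of the link operator of `e` modulo the gauge group.
  have hred : ∀ e ∈ H.edgeSet, ∃ q : V → ZMod 2 × ZMod 2, ∃ u : V,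
      toVec (on e (c e)) + q ∈ N ∧ (∀ v, q v ≠ 0 → e.ncard = 3 ∧ v = u) := by
    intro e he
    rcases hrank e he with h2 | h3
    · obtain ⟨u, v, huv, rfl⟩ := Set.ncard_eq_two.1 h2
      refine ⟨0, u, ?_, fun v hv => absurd rfl hv⟩
      rw [add_zero, toVec_on_pair huv]
      exact site_add_site_mem_gaugeSpace he (by simp) (by simp)
    · obtain ⟨u, v, w, huv, huw, hvw, rfl⟩ := Set.ncard_eq_three.1 h3
      refine ⟨site u (c {u, v, w}).vec, u, ?_, fun x hx => ⟨h3, ?_⟩⟩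
      · have : toVec (on {u, v, w} (c {u, v, w})) + site u (c {u, v, w}).vec =
            site v (c {u, v, w}).vec + site w (c {u, v, w}).vec := by
          funext x
          simp only [Pi.add_apply, toVec_on, site_apply]
          by_cases h1 : x = u
          · subst h1
            simp only [Set.mem_insert_iff, true_or, if_true, if_neg huv, if_neg huw, add_zero]
            exact congrFun (add_self_vec fun _ => (c {x, v, w}).vec) x
          · by_cases h2 : x = v
            · subst h2
              simp [h1, hvw]
            · by_cases h3 : x = w
              · subst h3
                simp [h1, h2]
              · simp [h1, h2, h3]
        rw [this]
        exact site_add_site_mem_gaugeSpace he (by simp) (by simp)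
      · by_contra hxu
        rw [site_apply, if_neg hxu] at hx
        exact hx rfl
  have hred' : ∀ e : Set V, ∃ q : V → ZMod 2 × ZMod 2, ∃ u : V, e ∈ H.edgeSet →
      toVec (on e (c e)) + q ∈ N ∧ (∀ v, q v ≠ 0 → e.ncard = 3 ∧ v = u) := by
    intro e
    by_cases he : e ∈ H.edgeSet
    · obtain ⟨q, u, h⟩ := hred e he
      exact ⟨q, u, fun _ => h⟩
    · have : Nonempty V := by
        by_contra hV
        rw [not_nonempty_iff] at hV
        refine hWN ?_
        rw [Subsingleton.elim (toVec (cycleOperator c σ)) 0]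
        exact N.zero_mem
      exact ⟨0, Classical.arbitrary V, fun h => absurd h he⟩
  choose q u hq using hred'
  obtain ⟨g, hg⟩ := toVec_surjective (∑ e ∈ σ, q e)
  have hdiff : toVec (cycleOperator c σ) + toVec g ∈ N := by
    rw [toVec_cycleOperator, hg, ← Finset.sum_add_distrib]
    exact N.sum_mem fun e he => (hq e (hσ.1 e he)).1
  have hg' : toVec g = toVec (cycleOperator c σ) + (toVec (cycleOperator c σ) + toVec g) := by
    rw [← add_assoc, add_self_vec, zero_add]
  have hgN : g ∉ ofSubspace N := by
    intro h
    refine hWN ?_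
    have := N.add_mem hdiff h
    rwa [add_assoc, add_self_vec, add_zero] at this
  have hgC : g ∈ Subgroup.centralizer (stabilizer (ofSubspace N) : Set (Pauli V)) := by
    rw [stabilizer_ofSubspace, centralizer_ofSubspace, mem_ofSubspace, hg']
    refine Submodule.add_mem _ (mem_orthogonal.2 fun s hs => mem_orthogonal.1 hW s hs.1)
      (mem_orthogonal.2 fun s hs => ?_)
    rw [form_comm]
    exact mem_orthogonal.1 hs.2 _ hdiff
  have hweight : g.weight ≤ numRankThree σ := by
    have hsub : {v | g.x v ≠ 0 ∨ g.z v ≠ 0} ⊆ u '' {e | e ∈ σ ∧ e.ncard = 3} := by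
      intro v hv
      have hv' : toVec g v ≠ 0 := by
        intro h
        rcases hv with hv | hv
        · exact hv (congrArg Prod.fst h)
        · exact hv (congrArg Prod.snd h)
      rw [hg, Finset.sum_apply] at hv'
      obtain ⟨e, he, hne⟩ := Finset.exists_ne_zero_of_sum_ne_zero hv'
      obtain ⟨h3, rfl⟩ := (hq e (hσ.1 e he)).2 v hne
      exact ⟨e, ⟨he, h3⟩, rfl⟩
    have hfin : {e | e ∈ σ ∧ e.ncard = 3}.Finite := σ.finite_toSet.subset fun e he => he.1
    exact (Set.ncard_le_ncard hsub (hfin.image u)).trans (Set.ncard_image_le hfin)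
  exact (iInf_le _ (⟨g, hgC, hgN⟩ : {g : Pauli V // _})).trans (by exact_mod_cast hweight)

end Hypergraph

/-! ### Counting flags -/

theorem Nat.card_eq_mul_of_ncard_fiber {A B : Type*} [Finite A] {f : A → B}
    (hf : Function.Surjective f) {k : ℕ} (hk : ∀ x, {y | f y = f x}.ncard = k) :
    Nat.card A = k * Nat.card B := by
  classical
  have : Finite B := Finite.of_surjective f hf
  have := Fintype.ofFinite A
  have := Fintype.ofFinite B
  rw [Nat.card_eq_fintype_card, Nat.card_eq_fintype_card, ← Finset.card_univ,
    Finset.card_eq_sum_card_fiberwise (f := f) (t := Finset.univ) fun _ _ => Finset.mem_univ _]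
  rw [Finset.sum_congr rfl (g := fun _ => k), Finset.sum_const, Finset.card_univ, smul_eq_mul,
    mul_comm]
  intro b _
  obtain ⟨x, rfl⟩ := hf b
  rw [← hk x, ← Set.ncard_coe_finset]
  congr 1
  ext y
  simp

namespace SurfaceMap

variable {Φ : Type*} (M : SurfaceMap Φ)

/-- The pairs of flags exchanged by `α i`: the sides of edges for `i = 0`, the corners for `i = 1`,
the half-edges for `i = 2`. -/
def FlagPair (i : Fin 3) : Type _ := Quot fun x y : Φ => y = M.α i x

/-- The pair of a flag. -/
def flagPair (i : Fin 3) (x : Φ) : M.FlagPair i := Quot.mk _ x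

variable {M}

@[simp]
theorem α_α (i : Fin 3) (x : Φ) : M.α i (M.α i x) = x := M.involutive i x

@[simp]
theorem flagPair_α (i : Fin 3) (x : Φ) : M.flagPair i (M.α i x) = M.flagPair i x :=
  (Quot.sound (r := fun x y : Φ => y = M.α i x) rfl).symm

theorem flagPair_eq_iff {i : Fin 3} {x y : Φ} :
    M.flagPair i x = M.flagPair i y ↔ x = y ∨ x = M.α i y := by
  constructor
  · intro h
    let p : M.FlagPair i → Prop := Quot.lift (fun z => z = y ∨ z = M.α i y) (by
      rintro a b rfl
      refine propext ⟨?_, ?_⟩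
      · rintro (rfl | rfl) <;> simp
      · rintro (h | h)
        · rw [← h, α_α]; simp
        · exact Or.inl ((M.involutive i).injective h))
    have : p (M.flagPair i y) := Or.inl rfl
    rw [← h] at this
    exact this
  · rintro (rfl | rfl) <;> simp

theorem cell_α {i j : Fin 3} (h : j ≠ i) (x : Φ) : M.cell i (M.α j x) = M.cell i x :=
  (Quot.sound ⟨j, h, rfl⟩).symm

variable [Finite Φ]

instance (i : Fin 3) : Finite (M.FlagPair i) := Quot.finite _

instance (i : Fin 3) : Finite (M.Cell i) := Quot.finite _

noncomputable instance (i : Fin 3) : Fintype (M.FlagPair i) := Fintype.ofFinite _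

noncomputable instance (i : Fin 3) : Fintype (M.Cell i) := Fintype.ofFinite _

theorem card_flags_eq_two_mul (i : Fin 3) : Nat.card Φ = 2 * Nat.card (M.FlagPair i) := by
  refine Nat.card_eq_mul_of_ncard_fiber (f := M.flagPair i) Quot.mk_surjective fun x => ?_
  have : {y | M.flagPair i y = M.flagPair i x} = {x, M.α i x} := by
    ext y
    exact flagPair_eq_iff
  rw [this, Set.ncard_pair (M.no_fixed i x).symm]

omit [Finite Φ] in
theorem cell_one_eq_iff {x y : Φ} : M.cell 1 x = M.cell 1 y ↔
    x = y ∨ x = M.α 0 y ∨ x = M.α 2 y ∨ x = M.α 0 (M.α 2 y) := by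
  constructor
  · intro h
    have step : ∀ a j, j ≠ (1 : Fin 3) →
        (a = y ∨ a = M.α 0 y ∨ a = M.α 2 y ∨ a = M.α 0 (M.α 2 y)) →
        (M.α j a = y ∨ M.α j a = M.α 0 y ∨ M.α j a = M.α 2 y ∨ M.α j a = M.α 0 (M.α 2 y)) := by
      intro a j hj
      have hj' : j = 0 ∨ j = 2 := by revert j; decide
      rcases hj' with rfl | rfl <;> rintro (rfl | rfl | rfl | rfl) <;> simp [M.comm]
    let p : M.Cell 1 → Prop :=
      Quot.lift (fun z => z = y ∨ z = M.α 0 y ∨ z = M.α 2 y ∨ z = M.α 0 (M.α 2 y)) (by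
        rintro a b ⟨j, hj, rfl⟩
        refine propext ⟨step a j hj, fun h => ?_⟩
        simpa only [α_α] using step _ j hj h)
    have : p (M.cell 1 y) := Or.inl rfl
    rw [← h] at this
    exact this
  · rintro (rfl | rfl | rfl | rfl) <;> simp [cell_α]

theorem card_flags_eq_four_mul : Nat.card Φ = 4 * M.numEdges := by
  refine Nat.card_eq_mul_of_ncard_fiber (f := M.cell 1) Quot.mk_surjective fun x => ?_
  have h0 := M.no_fixed 0
  have h2 := M.no_fixed 2
  have h02 := M.no_fixed_edge
  have hne : M.α 0 x ≠ M.α 2 x := fun h => h02 x (by rw [← h, α_α])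
  have : {y | M.cell 1 y = M.cell 1 x} = {x, M.α 0 x, M.α 2 x, M.α 0 (M.α 2 x)} := by
    ext y
    exact cell_one_eq_iff
  rw [this, Set.ncard_insert_of_notMem, Set.ncard_insert_of_notMem, Set.ncard_pair (h0 _).symm]
  · rintro (h | h)
    · exact hne h
    · exact h2 x ((M.involutive 0).injective h.symm)
  · rintro (h | h | h)
    · exact h0 x h.symm
    · exact h2 x h.symm
    · exact h02 x h.symm

omit [Finite Φ] in
/-- A function on flags that is invariant under the `α j`, `j ≠ i`, is a function on the cells of
dimension `i`. -/
theorem exists_cell_lift {A : Type*} {i : Fin 3} (f : Φ → A)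
    (hf : ∀ j, j ≠ i → ∀ x, f (M.α j x) = f x) : ∃ g : M.Cell i → A, ∀ x, g (M.cell i x) = f x :=
  ⟨Quot.lift f (by rintro a b ⟨j, hj, rfl⟩; exact (hf j hj a).symm), fun _ => rfl⟩

/-! ### Corners around a vertex of even degree -/

omit [Finite Φ] in
theorem Loopless.α_zero_ne_α_one (h : M.Loopless) (x : Φ) : M.α 0 x ≠ M.α 1 x := fun he =>
  h x (by rw [he, cell_α (by decide)])

omit [Finite Φ] in
theorem α_one_α_two_ne (h : ∀ v : M.Vertex, 2 < M.degree v) (x : Φ) :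
    M.α 1 (M.α 2 x) ≠ M.α 2 (M.α 1 x) := by
  intro hx
  have hx' : M.α 2 (M.α 1 (M.α 2 x)) = M.α 1 x := by rw [hx, α_α]
  have hx'' : M.α 1 (M.α 2 (M.α 1 x)) = M.α 2 x := by rw [← hx, α_α]
  have step : ∀ a j, j ≠ (0 : Fin 3) →
      (a = x ∨ a = M.α 2 x ∨ a = M.α 1 x ∨ a = M.α 2 (M.α 1 x)) →
      (M.α j a = x ∨ M.α j a = M.α 2 x ∨ M.α j a = M.α 1 x ∨ M.α j a = M.α 2 (M.α 1 x)) := by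
    intro a j hj
    have hj' : j = 1 ∨ j = 2 := by revert j; decide
    rcases hj' with rfl | rfl <;> rintro (rfl | rfl | rfl | rfl) <;> simp [hx, hx'']
  let p : M.Cell 0 → Prop :=
    Quot.lift (fun z => z = x ∨ z = M.α 2 x ∨ z = M.α 1 x ∨ z = M.α 2 (M.α 1 x)) (by
      rintro a b ⟨j, hj, rfl⟩
      refine propext ⟨step a j hj, fun h => ?_⟩
      simpa only [α_α] using step _ j hj h)
  have hsub : M.edgeEnd '' {y | M.cell 0 y = M.cell 0 x} ⊆ {M.edgeEnd x, M.edgeEnd (M.α 1 x)} := by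
    rintro _ ⟨y, hy, rfl⟩
    have : p (M.cell 0 x) := Or.inl rfl
    rw [← hy] at this
    rcases this with rfl | rfl | rfl | rfl
    · exact Or.inl rfl
    · exact Or.inl (flagPair_α (M := M) 2 x)
    · exact Or.inr rfl
    · exact Or.inr (flagPair_α (M := M) 2 _)
  have h1 := Set.ncard_le_ncard hsub (Set.toFinite _)
  have h2 := Set.ncard_insert_le (M.edgeEnd x) {M.edgeEnd (M.α 1 x)}
  rw [Set.ncard_singleton] at h2
  have h3 := h (M.cell 0 x)
  rw [degree] at h3
  omega

omit [Finite Φ] in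
theorem α_one_ne_α_two (h : ∀ v : M.Vertex, 2 < M.degree v) (x : Φ) : M.α 1 x ≠ M.α 2 x := by
  intro hx
  refine α_one_α_two_ne h x ?_
  rw [← hx, α_α, hx, α_α]

/-- The corners around each vertex of even degree can be coloured alternately.  The obstruction to
solving the equations `y (corner of x) + y (corner of α 2 x) = 1` for the half-edges is a functional
on half-edges that vanishes on coboundaries of corners; such a functional is constant around each
vertex, so its value on the right-hand side is a combination of the vertex degrees. -/
theorem exists_alternating (heven : ∀ v : M.Vertex, Even (M.degree v)) :
    ∃ y : Φ → ZMod 2, (∀ x, y (M.α 1 x) = y x) ∧ ∀ x, y (M.α 2 x) = y x + 1 := by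
  classical
  let T : (M.FlagPair 1 → ZMod 2) →ₗ[ZMod 2] (M.FlagPair 2 → ZMod 2) :=
    { toFun := fun y => Quot.lift (fun x => y (M.flagPair 1 x) + y (M.flagPair 1 (M.α 2 x))) (by
        rintro a b rfl
        rw [α_α, add_comm])
      map_add' := fun y y' => funext <| Quot.ind fun x => add_add_add_comm _ _ _ _
      map_smul' := fun t y => funext <| Quot.ind fun x => (mul_add t _ _).symm }
  have hT : ∀ y x, T y (M.flagPair 2 x) = y (M.flagPair 1 x) + y (M.flagPair 1 (M.α 2 x)) :=
    fun _ _ => rfl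
  suffices h1 : (1 : M.FlagPair 2 → ZMod 2) ∈ LinearMap.range T by
    obtain ⟨y, hy⟩ := h1
    refine ⟨fun x => y (M.flagPair 1 x), fun x => congrArg y (flagPair_α 1 x), fun x => ?_⟩
    have := congrFun hy (M.flagPair 2 x)
    rw [hT, Pi.one_apply] at this
    rw [← this, ← add_assoc, CharTwo.add_self_eq_zero, zero_add]
  by_contra hnot
  obtain ⟨f, hf1, hf⟩ := Submodule.exists_le_ker_of_notMem hnot
  refine hf1 ?_
  have hsum := fun w => LinearMap.pi_apply_eq_sum_univ f w
  set l : M.FlagPair 2 → ZMod 2 := fun h => f fun j => if h = j then 1 else 0 with hl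
  have hconst : ∀ x, l (M.flagPair 2 (M.α 1 x)) = l (M.flagPair 2 x) := by
    intro x
    have h0 : f (T (Pi.single (M.flagPair 1 x) 1)) = 0 := hf ⟨_, rfl⟩
    have hTs : T (Pi.single (M.flagPair 1 x) 1) =
        (fun j => if M.flagPair 2 x = j then 1 else 0) +
          fun j => if M.flagPair 2 (M.α 1 x) = j then 1 else 0 := by
      funext j
      induction j using Quot.ind with
      | mk z =>
        change T _ (M.flagPair 2 z) = (if M.flagPair 2 x = M.flagPair 2 z then 1 else 0) +
          if M.flagPair 2 (M.α 1 x) = M.flagPair 2 z then 1 else 0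
        have hor : ∀ (i : Fin 3) (a b : Φ),
            (if M.flagPair i a = M.flagPair i b then 1 else 0 : ZMod 2) =
              (if a = b then 1 else 0) + if a = M.α i b then 1 else 0 := by
          intro i a b
          by_cases h1 : a = b
          · subst h1
            simp [(M.no_fixed i a).symm]
          · by_cases h2 : a = M.α i b
            · subst h2
              simp [M.no_fixed i b]
            · simp [flagPair_eq_iff, h1, h2]
        have hsw : ∀ a b : Φ, (if a = M.α 1 b then 1 else 0 : ZMod 2) =
            if M.α 1 a = b then 1 else 0 := by
          intro a b
          have : a = M.α 1 b ↔ M.α 1 a = b := by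
            constructor <;> rintro rfl <;> simp
          simp only [this]
        rw [hT, Pi.single_apply, Pi.single_apply, eq_comm, eq_comm (b := M.flagPair 1 x),
          eq_comm (b := M.flagPair 1 x), hor, hor, hor, hor, hsw, hsw]
        ring
    rw [hTs, map_add, CharTwo.add_eq_zero] at h0
    exact h0.symm
  have hL : ∃ L : M.Vertex → ZMod 2, ∀ x, L (M.cell 0 x) = l (M.flagPair 2 x) := by
    refine exists_cell_lift _ fun j hj x => ?_
    have hj' : j = 1 ∨ j = 2 := by revert j; decide
    rcases hj' with rfl | rfl
    · exact hconst x
    · rw [flagPair_α]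
  obtain ⟨L, hL⟩ := hL
  let base : M.FlagPair 2 → M.Vertex := Quot.lift (M.cell 0) (by
    rintro a b rfl
    rw [cell_α (by decide)])
  have hbase : ∀ h, l h = L (base h) := Quot.ind fun x => (hL x).symm
  rw [hsum]
  calc ∑ h, (1 : M.FlagPair 2 → ZMod 2) h • l h = ∑ h, L (base h) :=
        Finset.sum_congr rfl fun h _ => by rw [Pi.one_apply, one_smul, hbase]
    _ = ∑ v, ∑ h with base h = v, L (base h) := (Finset.sum_fiberwise _ base _).symm
    _ = ∑ v : M.Vertex, (M.degree v : ZMod 2) * L v := by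
      refine Finset.sum_congr rfl fun v _ => ?_
      rw [Finset.sum_congr rfl (g := fun _ => L v), Finset.sum_const, nsmul_eq_mul]
      · congr 2
        rw [degree, ← Set.ncard_coe_finset]
        congr 1
        ext h
        induction h using Quot.ind with
        | mk x =>
          simp only [Finset.coe_filter, Finset.mem_univ, true_and]
          constructor
          · exact fun h => ⟨x, h, rfl⟩
          · rintro ⟨z, hz, hzx⟩
            rw [← hz]
            exact (congrArg base hzx).symm
      · intro h hh
        rw [(Finset.mem_filter.1 hh).2]
    _ = 0 := Finset.sum_eq_zero fun v _ => by
      rw [(ZMod.natCast_eq_zero_iff_even).2 (heven v), zero_mul]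

end SurfaceMap

/-! ### The hypergraph of a medial graph -/

namespace SurfaceMap

variable {Φ : Type*} (M : SurfaceMap Φ)

/-- The vertex of the 2-colex at the flag `x` and on the side of its vertex (`t = true`) or of its
face (`t = false`). -/
def colexVertex (t : Bool) (x : Φ) : M.MedialHVertex := Sum.inl (x, t)

/-- The new vertex that belongs to the half-edge of `x`. -/
def innerVertex (x : Φ) : M.MedialHVertex :=
  M.medialColex.newVertex 0 1 M.vertexFaces (x, true) ⟨x, rfl⟩

/-- The edge that joins the vertex side of a flag to its face side (colour `0` in the 2-colex). -/
def linkEdge (x : Φ) : Set M.MedialHVertex := {M.colexVertex true x, M.colexVertex false x}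

/-- The edge across a corner (colour `2` in the 2-colex), on the side `t`. -/
def cornerEdge (t : Bool) (x : Φ) : Set M.MedialHVertex :=
  {M.colexVertex t x, M.colexVertex t (M.α 1 x)}

/-- The edge along a side of an edge of `M` (colour `1` in the 2-colex, not promoted). -/
def sideEdge (x : Φ) : Set M.MedialHVertex :=
  {M.colexVertex false x, M.colexVertex false (M.α 0 x)}

/-- The rank-3 edge of the half-edge of `x`. -/
def promotedEdge (x : Φ) : Set M.MedialHVertex :=
  {M.colexVertex true x, M.colexVertex true (M.α 2 x), M.innerVertex x}

/-- The edge of an inner face that belongs to the corner of `x`. -/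
def innerEdge (x : Φ) : Set M.MedialHVertex := {M.innerVertex x, M.innerVertex (M.α 1 x)}

variable {M}

theorem face_mem_vertexFaces {w : Φ × Bool} :
    M.medialColex.face 0 w ∈ M.vertexFaces ↔ w.2 = true := by
  constructor
  · rintro ⟨x, hx⟩
    let p : M.medialColex.Face 0 → Bool := Quot.lift (fun w => w.2) (by
      rintro ⟨a, s⟩ b ⟨j, hj, rfl⟩
      have hj' : j = 1 ∨ j = 2 := by revert j; decide
      rcases hj' with rfl | rfl <;> rfl)
    exact (congrArg p hx).symm
  · obtain ⟨x, t⟩ := w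
    rintro rfl
    exact ⟨x, rfl⟩

theorem colexVertex_inj {s t : Bool} {x y : Φ} :
    M.colexVertex s x = M.colexVertex t y ↔ s = t ∧ x = y := by
  simp [colexVertex, and_comm]

theorem colexVertex_ne_innerVertex (t : Bool) (x y : Φ) :
    M.colexVertex t x ≠ M.innerVertex y := Sum.inl_ne_inr

theorem innerVertex_ne_colexVertex (t : Bool) (x y : Φ) :
    M.innerVertex y ≠ M.colexVertex t x := Sum.inr_ne_inl

theorem innerVertex_eq_iff {x y : Φ} :
    M.innerVertex x = M.innerVertex y ↔ x = y ∨ x = M.α 2 y := by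
  have h1 : M.innerVertex x = M.innerVertex y ↔
      M.medialColex.edge 1 (x, true) = M.medialColex.edge 1 (y, true) :=
    ⟨fun h => Subtype.ext_iff.1 (Sum.inr_injective h),
      fun h => congrArg Sum.inr (Subtype.ext h)⟩
  rw [h1]
  constructor
  · intro h
    let p : M.medialColex.Edge 1 → Prop :=
      Quot.lift (fun w => w.1 = y ∧ w.2 = true ∨ w.1 = M.α 2 y ∧ w.2 = true) (by
        rintro ⟨a, s⟩ b rfl
        cases s
        · simp [medialColex, toColex, dual, medial, medialFlip]
        · change (a = y ∧ true = true ∨ a = M.α 2 y ∧ true = true) =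
            (M.α 2 a = y ∧ true = true ∨ M.α 2 a = M.α 2 y ∧ true = true)
          simp only [and_true, (M.involutive 2).injective.eq_iff]
          rw [or_comm, (M.involutive 2).eq_iff])
    have : p (M.medialColex.edge 1 (y, true)) := Or.inl ⟨rfl, rfl⟩
    rw [← h] at this
    exact this.imp And.left And.left
  · rintro (rfl | rfl)
    · rfl
    · exact (Quot.sound (r := fun w w' => w' = M.medialColex.β 1 w) (a := (y, true)) rfl).symm

@[simp]
theorem innerVertex_α_two (x : Φ) : M.innerVertex (M.α 2 x) = M.innerVertex x :=
  innerVertex_eq_iff.2 (Or.inr rfl)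

theorem eq_colexVertex_or_eq_innerVertex (v : M.MedialHVertex) :
    (∃ t x, v = M.colexVertex t x) ∨ ∃ x, v = M.innerVertex x := by
  rcases v with ⟨x, t⟩ | ⟨ε, ⟨x, t⟩, hx, rfl⟩
  · exact Or.inl ⟨t, x, rfl⟩
  · have ht : t = true := face_mem_vertexFaces.1 hx
    subst ht
    exact Or.inr ⟨x, rfl⟩

theorem mem_edgeSet_medialHypergraph {e : Set M.MedialHVertex} :
    e ∈ M.medialHypergraph.edgeSet ↔ (∃ x, e = M.linkEdge x) ∨ (∃ t x, e = M.cornerEdge t x) ∨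
      (∃ x, e = M.sideEdge x) ∨ (∃ x, e = M.promotedEdge x) ∨ ∃ x, e = M.innerEdge x := by
  constructor
  · rintro ((⟨c, ⟨x, t⟩, hc, rfl⟩ | ⟨⟨x, t⟩, hx, rfl⟩) | ⟨q, ⟨x, t⟩, hx, hy, hq0, hq1, rfl⟩)
    · have hc' : ∀ c : Fin 3, c = 0 ∨ c = 1 ∨ c = 2 := by decide
      rcases hc' c with rfl | rfl | rfl
      · refine Or.inl ⟨x, ?_⟩
        cases t
        · exact Set.pair_comm _ _
        · rfl
      · cases t
        · exact Or.inr (Or.inr (Or.inl ⟨x, rfl⟩))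
        · exact absurd ⟨rfl, face_mem_vertexFaces.2 rfl⟩ hc
      · exact Or.inr (Or.inl ⟨t, x, rfl⟩)
    · have ht : t = true := face_mem_vertexFaces.1 hx
      subst ht
      exact Or.inr (Or.inr (Or.inr (Or.inl ⟨x, rfl⟩)))
    · have ht : t = true := face_mem_vertexFaces.1 hx
      subst ht
      have hq : ∀ q : Fin 3, q ≠ 0 → q ≠ 1 → q = 2 := by decide
      obtain rfl := hq q hq0 hq1
      exact Or.inr (Or.inr (Or.inr (Or.inr ⟨x, rfl⟩)))
  · rintro (⟨x, rfl⟩ | ⟨t, x, rfl⟩ | ⟨x, rfl⟩ | ⟨x, rfl⟩ | ⟨x, rfl⟩)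
    · exact Or.inl (Or.inl ⟨0, (x, true), fun h => absurd h.1 (by decide), rfl⟩)
    · exact Or.inl (Or.inl ⟨2, (x, t), fun h => absurd h.1 (by decide), rfl⟩)
    · refine Or.inl (Or.inl ⟨1, (x, false), fun h => ?_, rfl⟩)
      exact Bool.false_ne_true (face_mem_vertexFaces.1 h.2)
    · exact Or.inl (Or.inr ⟨(x, true), face_mem_vertexFaces.2 rfl, rfl⟩)
    · exact Or.inr ⟨2, (x, true), face_mem_vertexFaces.2 rfl, face_mem_vertexFaces.2 rfl,
        by decide, by decide, rfl⟩

theorem linkEdge_mem (x : Φ) : M.linkEdge x ∈ M.medialHypergraph.edgeSet :=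
  mem_edgeSet_medialHypergraph.2 (Or.inl ⟨x, rfl⟩)

theorem cornerEdge_mem (t : Bool) (x : Φ) : M.cornerEdge t x ∈ M.medialHypergraph.edgeSet :=
  mem_edgeSet_medialHypergraph.2 (Or.inr (Or.inl ⟨t, x, rfl⟩))

theorem sideEdge_mem (x : Φ) : M.sideEdge x ∈ M.medialHypergraph.edgeSet :=
  mem_edgeSet_medialHypergraph.2 (Or.inr (Or.inr (Or.inl ⟨x, rfl⟩)))

theorem promotedEdge_mem (x : Φ) : M.promotedEdge x ∈ M.medialHypergraph.edgeSet :=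
  mem_edgeSet_medialHypergraph.2 (Or.inr (Or.inr (Or.inr (Or.inl ⟨x, rfl⟩))))

theorem innerEdge_mem (x : Φ) : M.innerEdge x ∈ M.medialHypergraph.edgeSet :=
  mem_edgeSet_medialHypergraph.2 (Or.inr (Or.inr (Or.inr (Or.inr ⟨x, rfl⟩))))

theorem cornerEdge_α_one (t : Bool) (x : Φ) : M.cornerEdge t (M.α 1 x) = M.cornerEdge t x := by
  rw [cornerEdge, cornerEdge, α_α, Set.pair_comm]

theorem sideEdge_α_zero (x : Φ) : M.sideEdge (M.α 0 x) = M.sideEdge x := by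
  rw [sideEdge, sideEdge, α_α, Set.pair_comm]

theorem promotedEdge_α_two (x : Φ) : M.promotedEdge (M.α 2 x) = M.promotedEdge x := by
  rw [promotedEdge, promotedEdge, α_α, innerVertex_α_two, Set.insert_comm]

theorem innerEdge_α_one (x : Φ) : M.innerEdge (M.α 1 x) = M.innerEdge x := by
  rw [innerEdge, innerEdge, α_α, Set.pair_comm]

theorem eq_of_colexVertex_true_mem {e : Set M.MedialHVertex} (he : e ∈ M.medialHypergraph.edgeSet)
    {x : Φ} (hx : M.colexVertex true x ∈ e) :
    e = M.linkEdge x ∨ e = M.cornerEdge true x ∨ e = M.promotedEdge x := by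
  rcases mem_edgeSet_medialHypergraph.1 he with
    ⟨z, rfl⟩ | ⟨t, z, rfl⟩ | ⟨z, rfl⟩ | ⟨z, rfl⟩ | ⟨z, rfl⟩
  · simp [linkEdge, colexVertex_inj] at hx
    simp [hx]
  · simp only [cornerEdge, Set.mem_insert_iff, Set.mem_singleton_iff, colexVertex_inj] at hx
    rcases hx with ⟨rfl, rfl⟩ | ⟨rfl, rfl⟩ <;> simp [cornerEdge_α_one]
  · simp [sideEdge, colexVertex_inj] at hx
  · simp only [promotedEdge, Set.mem_insert_iff, Set.mem_singleton_iff, colexVertex_inj,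
      colexVertex_ne_innerVertex, or_false, true_and] at hx
    rcases hx with rfl | rfl <;> simp [promotedEdge_α_two]
  · simp [innerEdge, colexVertex_ne_innerVertex] at hx

theorem eq_of_colexVertex_false_mem {e : Set M.MedialHVertex}
    (he : e ∈ M.medialHypergraph.edgeSet) {x : Φ} (hx : M.colexVertex false x ∈ e) :
    e = M.linkEdge x ∨ e = M.cornerEdge false x ∨ e = M.sideEdge x := by
  rcases mem_edgeSet_medialHypergraph.1 he with
    ⟨z, rfl⟩ | ⟨t, z, rfl⟩ | ⟨z, rfl⟩ | ⟨z, rfl⟩ | ⟨z, rfl⟩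
  · simp [linkEdge, colexVertex_inj] at hx
    simp [hx]
  · simp only [cornerEdge, Set.mem_insert_iff, Set.mem_singleton_iff, colexVertex_inj] at hx
    rcases hx with ⟨rfl, rfl⟩ | ⟨rfl, rfl⟩ <;> simp [cornerEdge_α_one]
  · simp only [sideEdge, Set.mem_insert_iff, Set.mem_singleton_iff, colexVertex_inj,
      true_and] at hx
    rcases hx with rfl | rfl <;> simp [sideEdge_α_zero]
  · simp [promotedEdge, colexVertex_inj, colexVertex_ne_innerVertex] at hx
  · simp [innerEdge, colexVertex_ne_innerVertex] at hx

theorem eq_of_innerVertex_mem {e : Set M.MedialHVertex}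
    (he : e ∈ M.medialHypergraph.edgeSet) {x : Φ} (hx : M.innerVertex x ∈ e) :
    e = M.promotedEdge x ∨ e = M.innerEdge x ∨ e = M.innerEdge (M.α 2 x) := by
  rcases mem_edgeSet_medialHypergraph.1 he with
    ⟨z, rfl⟩ | ⟨t, z, rfl⟩ | ⟨z, rfl⟩ | ⟨z, rfl⟩ | ⟨z, rfl⟩
  · simp [linkEdge, innerVertex_ne_colexVertex] at hx
  · simp [cornerEdge, innerVertex_ne_colexVertex] at hx
  · simp [sideEdge, innerVertex_ne_colexVertex] at hx
  · simp only [promotedEdge, Set.mem_insert_iff, Set.mem_singleton_iff,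
      innerVertex_ne_colexVertex, false_or, innerVertex_eq_iff] at hx
    rcases hx with rfl | rfl <;> simp [promotedEdge_α_two]
  · simp only [innerEdge, Set.mem_insert_iff, Set.mem_singleton_iff, innerVertex_eq_iff] at hx
    rcases hx with (rfl | rfl) | (rfl | hx)
    · simp
    · simp
    · simp [innerEdge_α_one]
    · rw [hx, α_α, innerEdge_α_one]
      simp

theorem linkEdge_ne_cornerEdge (x : Φ) (t : Bool) (z : Φ) : M.linkEdge x ≠ M.cornerEdge t z := by
  intro h
  have h1 : M.colexVertex (!t) x ∈ M.cornerEdge t z := by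
    rw [← h]
    cases t <;> simp [linkEdge]
  cases t <;> simp [cornerEdge, colexVertex_inj] at h1

theorem linkEdge_ne_sideEdge (x z : Φ) : M.linkEdge x ≠ M.sideEdge z := by
  intro h
  have h1 : M.colexVertex true x ∈ M.sideEdge z := by rw [← h]; simp [linkEdge]
  simp [sideEdge, colexVertex_inj] at h1

theorem linkEdge_ne_promotedEdge (x z : Φ) : M.linkEdge x ≠ M.promotedEdge z := by
  intro h
  have h1 : M.innerVertex z ∈ M.linkEdge x := by rw [h]; simp [promotedEdge]
  simp [linkEdge, innerVertex_ne_colexVertex] at h1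

theorem linkEdge_ne_innerEdge (x z : Φ) : M.linkEdge x ≠ M.innerEdge z := by
  intro h
  have h1 : M.innerVertex z ∈ M.linkEdge x := by rw [h]; simp [innerEdge]
  simp [linkEdge, innerVertex_ne_colexVertex] at h1

theorem cornerEdge_ne_sideEdge (hloop : M.Loopless) (t : Bool) (x z : Φ) :
    M.cornerEdge t x ≠ M.sideEdge z := by
  intro h
  have h1 : M.colexVertex t x ∈ M.sideEdge z := by rw [← h]; simp [cornerEdge]
  have h2 : M.colexVertex t (M.α 1 x) ∈ M.sideEdge z := by rw [← h]; simp [cornerEdge]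
  simp only [sideEdge, Set.mem_insert_iff, Set.mem_singleton_iff, colexVertex_inj] at h1 h2
  rcases h1 with ⟨-, rfl⟩ | ⟨-, rfl⟩ <;> rcases h2 with ⟨-, h2⟩ | ⟨-, h2⟩
  · exact M.no_fixed 1 _ h2
  · exact hloop.α_zero_ne_α_one _ h2.symm
  · refine hloop.α_zero_ne_α_one (M.α 0 z) ?_
    rw [h2, α_α]
  · exact M.no_fixed 1 _ h2

theorem cornerEdge_ne_promotedEdge (t : Bool) (x z : Φ) :
    M.cornerEdge t x ≠ M.promotedEdge z := by
  intro h
  have h1 : M.innerVertex z ∈ M.cornerEdge t x := by rw [h]; simp [promotedEdge]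
  simp [cornerEdge, innerVertex_ne_colexVertex] at h1

theorem cornerEdge_ne_innerEdge (t : Bool) (x z : Φ) : M.cornerEdge t x ≠ M.innerEdge z := by
  intro h
  have h1 : M.innerVertex z ∈ M.cornerEdge t x := by rw [h]; simp [innerEdge]
  simp [cornerEdge, innerVertex_ne_colexVertex] at h1

theorem sideEdge_ne_innerEdge (x z : Φ) : M.sideEdge x ≠ M.innerEdge z := by
  intro h
  have h1 : M.innerVertex z ∈ M.sideEdge x := by rw [h]; simp [innerEdge]
  simp [sideEdge, innerVertex_ne_colexVertex] at h1

theorem promotedEdge_ne_innerEdge (x z : Φ) : M.promotedEdge x ≠ M.innerEdge z := by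
  intro h
  have h1 : M.colexVertex true x ∈ M.innerEdge z := by rw [← h]; simp [promotedEdge]
  simp [innerEdge, colexVertex_ne_innerVertex] at h1

/-- Two consecutive edges of an inner face are different, as the face is not a digon. -/
theorem innerEdge_α_two_ne (hdeg : ∀ v : M.Vertex, 2 < M.degree v) (x : Φ) :
    M.innerEdge (M.α 2 x) ≠ M.innerEdge x := by
  intro h
  have h1 : M.innerVertex (M.α 1 (M.α 2 x)) ∈ M.innerEdge x := by rw [← h]; simp [innerEdge]
  simp only [innerEdge, Set.mem_insert_iff, Set.mem_singleton_iff, innerVertex_eq_iff] at h1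
  rcases h1 with (h1 | h1) | (h1 | h1)
  · have h2 := congrArg (M.α 1) h1
    rw [α_α] at h2
    exact α_one_ne_α_two hdeg x h2.symm
  · exact M.no_fixed 1 _ h1
  · exact M.no_fixed 2 _ ((M.involutive 1).injective h1)
  · exact α_one_α_two_ne hdeg x h1

theorem ncard_linkEdge (x : Φ) : (M.linkEdge x).ncard = 2 :=
  Set.ncard_pair (by simp [colexVertex_inj])

theorem ncard_cornerEdge (t : Bool) (x : Φ) : (M.cornerEdge t x).ncard = 2 :=
  Set.ncard_pair (by simp [colexVertex_inj, (M.no_fixed 1 x).symm])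

theorem ncard_sideEdge (x : Φ) : (M.sideEdge x).ncard = 2 :=
  Set.ncard_pair (by simp [colexVertex_inj, (M.no_fixed 0 x).symm])

theorem ncard_promotedEdge (x : Φ) : (M.promotedEdge x).ncard = 3 := by
  rw [promotedEdge, Set.ncard_insert_of_notMem, Set.ncard_pair (colexVertex_ne_innerVertex _ _ _)]
  simp [colexVertex_inj, (M.no_fixed 2 x).symm, colexVertex_ne_innerVertex]

theorem ncard_innerEdge (hdeg : ∀ v : M.Vertex, 2 < M.degree v) (x : Φ) :
    (M.innerEdge x).ncard = 2 := by
  refine Set.ncard_pair fun h => ?_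
  rcases innerVertex_eq_iff.1 h with h | h
  · exact M.no_fixed 1 x h.symm
  · refine α_one_ne_α_two hdeg x ?_
    rw [h, α_α, ← h]

theorem ncard_eq_two_or_three (hdeg : ∀ v : M.Vertex, 2 < M.degree v) {e : Set M.MedialHVertex}
    (he : e ∈ M.medialHypergraph.edgeSet) : e.ncard = 2 ∨ e.ncard = 3 := by
  rcases mem_edgeSet_medialHypergraph.1 he with
    ⟨z, rfl⟩ | ⟨t, z, rfl⟩ | ⟨z, rfl⟩ | ⟨z, rfl⟩ | ⟨z, rfl⟩
  · exact Or.inl (ncard_linkEdge z)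
  · exact Or.inl (ncard_cornerEdge t z)
  · exact Or.inl (ncard_sideEdge z)
  · exact Or.inr (ncard_promotedEdge z)
  · exact Or.inl (ncard_innerEdge hdeg z)

/-! ### Edge-colourings of the hypergraph -/

theorem eq_of_innerEdge_eq (hdeg : ∀ v : M.Vertex, 2 < M.degree v) {y : Φ → ZMod 2}
    (hy : ∀ x, y (M.α 1 x) = y x) {x z : Φ} (h : M.innerEdge x = M.innerEdge z) : y x = y z := by
  have h1 : M.innerVertex x ∈ M.innerEdge z := by rw [← h]; simp [innerEdge]
  simp only [innerEdge, Set.mem_insert_iff, Set.mem_singleton_iff, innerVertex_eq_iff] at h1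
  rcases h1 with (rfl | rfl) | (rfl | rfl)
  · rfl
  · exact absurd h (innerEdge_α_two_ne hdeg z)
  · exact hy z
  · rw [← innerEdge_α_one z] at h
    exact absurd h (innerEdge_α_two_ne hdeg _)

theorem exists_isEdgeColoring [Finite Φ] (hloop : M.Loopless)
    (heven : ∀ v : M.Vertex, Even (M.degree v)) (hdeg : ∀ v : M.Vertex, 2 < M.degree v) :
    ∃ c, M.medialHypergraph.IsEdgeColoring c := by
  classical
  obtain ⟨y, hy1, hy2⟩ := exists_alternating heven
  let c : Set M.MedialHVertex → PauliLetter := fun e =>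
    if ∃ x, e = M.linkEdge x then .X
    else if ∃ t x, e = M.cornerEdge t x then .Y
    else if ∃ x, e = M.innerEdge x ∧ y x = 0 then .X
    else if ∃ x, e = M.innerEdge x then .Y
    else .Z
  have c0 : ∀ x, c (M.linkEdge x) = .X := fun x => if_pos ⟨x, rfl⟩
  have c2 : ∀ t x, c (M.cornerEdge t x) = .Y := by
    intro t x
    simp only [c, (linkEdge_ne_cornerEdge _ _ _).symm, exists_false, if_false]
    exact if_pos ⟨t, x, rfl⟩
  have c1 : ∀ x, c (M.sideEdge x) = .Z := by
    intro x
    simp only [c, (linkEdge_ne_sideEdge _ _).symm, (cornerEdge_ne_sideEdge hloop _ _ _).symm,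
      sideEdge_ne_innerEdge, exists_false, if_false, false_and]
  have c3 : ∀ x, c (M.promotedEdge x) = .Z := by
    intro x
    simp only [c, (linkEdge_ne_promotedEdge _ _).symm, (cornerEdge_ne_promotedEdge _ _ _).symm,
      promotedEdge_ne_innerEdge, exists_false, if_false, false_and]
  have cin : ∀ x, c (M.innerEdge x) = if y x = 0 then .X else .Y := by
    intro x
    have h1 : (∃ z, M.innerEdge x = M.innerEdge z ∧ y z = 0) ↔ y x = 0 := by
      constructor
      · rintro ⟨z, hz, hz0⟩
        rw [eq_of_innerEdge_eq hdeg hy1 hz, hz0]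
      · exact fun h => ⟨x, rfl, h⟩
    have h2 : ∃ z, M.innerEdge x = M.innerEdge z := ⟨x, rfl⟩
    simp only [c, (linkEdge_ne_innerEdge _ _).symm, (cornerEdge_ne_innerEdge _ _ _).symm,
      exists_false, if_false, h1, h2, if_true]
  refine ⟨c, ?_, ?_⟩
  · intro e he h3
    rcases mem_edgeSet_medialHypergraph.1 he with
      ⟨z, rfl⟩ | ⟨t, z, rfl⟩ | ⟨z, rfl⟩ | ⟨z, rfl⟩ | ⟨z, rfl⟩
    · rw [ncard_linkEdge] at h3; omega
    · rw [ncard_cornerEdge] at h3; omega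
    · exact c1 z
    · exact c3 z
    · rw [ncard_innerEdge hdeg] at h3; omega
  · rintro e he e' he' hne ⟨v, hv, hv'⟩
    rcases eq_colexVertex_or_eq_innerVertex v with ⟨t, x, rfl⟩ | ⟨x, rfl⟩
    · cases t
      · rcases eq_of_colexVertex_false_mem he hv with rfl | rfl | rfl <;>
          rcases eq_of_colexVertex_false_mem he' hv' with rfl | rfl | rfl <;>
          first | exact absurd rfl hne | simp [c0, c1, c2]
      · rcases eq_of_colexVertex_true_mem he hv with rfl | rfl | rfl <;>
          rcases eq_of_colexVertex_true_mem he' hv' with rfl | rfl | rfl <;>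
          first | exact absurd rfl hne | simp [c0, c2, c3]
    · have hval : ∀ a : ZMod 2, a = 0 ∨ a = 1 := by decide
      rcases eq_of_innerVertex_mem he hv with rfl | rfl | rfl <;>
        rcases eq_of_innerVertex_mem he' hv' with rfl | rfl | rfl <;>
        first
        | exact absurd rfl hne
        | rcases hval (y x) with h | h <;> simp [c3, cin, hy2, h, CharTwo.add_self_eq_zero]

section Letters

variable {c : Set M.MedialHVertex → PauliLetter}

theorem color_promotedEdge (hc : M.medialHypergraph.IsEdgeColoring c) (x : Φ) :
    c (M.promotedEdge x) = .Z := hc.1 _ (promotedEdge_mem x) (ncard_promotedEdge x)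

theorem color_linkEdge_ne_color_cornerEdge (hc : M.medialHypergraph.IsEdgeColoring c) (t : Bool)
    (x : Φ) : c (M.linkEdge x) ≠ c (M.cornerEdge t x) :=
  hc.2 _ (linkEdge_mem x) _ (cornerEdge_mem t x) (linkEdge_ne_cornerEdge _ _ _)
    ⟨M.colexVertex t x, by cases t <;> simp [linkEdge], by simp [cornerEdge]⟩

theorem color_linkEdge_ne_color_sideEdge (hc : M.medialHypergraph.IsEdgeColoring c)
    (x : Φ) : c (M.linkEdge x) ≠ c (M.sideEdge x) :=
  hc.2 _ (linkEdge_mem x) _ (sideEdge_mem x) (linkEdge_ne_sideEdge _ _)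
    ⟨M.colexVertex false x, by simp [linkEdge], by simp [sideEdge]⟩

theorem color_cornerEdge_ne_color_sideEdge (hloop : M.Loopless)
    (hc : M.medialHypergraph.IsEdgeColoring c) (x : Φ) :
    c (M.cornerEdge false x) ≠ c (M.sideEdge x) :=
  hc.2 _ (cornerEdge_mem false x) _ (sideEdge_mem x) (cornerEdge_ne_sideEdge hloop _ _ _)
    ⟨M.colexVertex false x, by simp [cornerEdge], by simp [sideEdge]⟩

theorem color_linkEdge_ne_Z (hc : M.medialHypergraph.IsEdgeColoring c) (x : Φ) :
    c (M.linkEdge x) ≠ .Z := by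
  rw [← color_promotedEdge hc x]
  exact hc.2 _ (linkEdge_mem x) _ (promotedEdge_mem x) (linkEdge_ne_promotedEdge _ _)
    ⟨M.colexVertex true x, by simp [linkEdge], by simp [promotedEdge]⟩

theorem color_cornerEdge_true_ne_Z (hc : M.medialHypergraph.IsEdgeColoring c) (x : Φ) :
    c (M.cornerEdge true x) ≠ .Z := by
  rw [← color_promotedEdge hc x]
  exact hc.2 _ (cornerEdge_mem true x) _ (promotedEdge_mem x) (cornerEdge_ne_promotedEdge _ _ _)
    ⟨M.colexVertex true x, by simp [cornerEdge], by simp [promotedEdge]⟩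

theorem color_innerEdge_ne_Z (hc : M.medialHypergraph.IsEdgeColoring c) (x : Φ) :
    c (M.innerEdge x) ≠ .Z := by
  rw [← color_promotedEdge hc x]
  exact hc.2 _ (innerEdge_mem x) _ (promotedEdge_mem x) (promotedEdge_ne_innerEdge _ _).symm
    ⟨M.innerVertex x, by simp [innerEdge], by simp [promotedEdge]⟩

theorem color_innerEdge_ne_color_innerEdge_α_two (hdeg : ∀ v : M.Vertex, 2 < M.degree v)
    (hc : M.medialHypergraph.IsEdgeColoring c) (x : Φ) :
    c (M.innerEdge x) ≠ c (M.innerEdge (M.α 2 x)) :=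
  hc.2 _ (innerEdge_mem x) _ (innerEdge_mem _) (innerEdge_α_two_ne hdeg x).symm
    ⟨M.innerVertex x, by simp [innerEdge], by simp [innerEdge]⟩

end Letters

/-! ### Counting vertices -/

theorem card_medialHVertex [Finite Φ] : Nat.card M.MedialHVertex = 10 * M.numEdges := by
  have hΦ := card_flags_eq_four_mul (M := M)
  let f : Φ → {ε : M.medialColex.Edge 1 // ∃ w, M.medialColex.face 0 w ∈ M.vertexFaces ∧
      M.medialColex.edge 1 w = ε} :=
    fun x => ⟨M.medialColex.edge 1 (x, true), (x, true), ⟨x, rfl⟩, rfl⟩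
  have hf : ∀ x, M.innerVertex x = Sum.inr (f x) := fun x => rfl
  have hsurj : Function.Surjective f := by
    intro ε
    rcases eq_colexVertex_or_eq_innerVertex (Sum.inr ε : M.MedialHVertex) with ⟨t, x, h⟩ | ⟨x, h⟩
    · exact absurd h Sum.inr_ne_inl
    · exact ⟨x, (Sum.inr_injective (h.trans (hf x))).symm⟩
  have hcard := Nat.card_eq_mul_of_ncard_fiber hsurj (k := 2) fun x => by
    have : {z | f z = f x} = {x, M.α 2 x} := by
      ext z
      rw [Set.mem_ofPred_eq, ← (Sum.inr_injective (α := Φ × Bool)).eq_iff, ← hf, ← hf,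
        innerVertex_eq_iff]
      rfl
    rw [this, Set.ncard_pair (M.no_fixed 2 x).symm]
  have : Finite (M.medialColex.Edge 1) := Quot.finite _
  rw [Nat.card_sum, Nat.card_prod, Nat.card_eq_fintype_card (α := Bool), Fintype.card_bool]
  omega

end SurfaceMap

/-! ### Coordinates on the gauge group -/

theorem PauliLetter.qubitForm_combination {K L M : PauliLetter} (hKL : K ≠ L) (hKM : K ≠ M)
    (hLM : L ≠ M) (a b c : ZMod 2) :
    Pauli.qubitForm (a • K.vec + b • L.vec + c • M.vec) K.vec = b + c ∧
      Pauli.qubitForm (a • K.vec + b • L.vec + c • M.vec) L.vec = a + c ∧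
      Pauli.qubitForm (a • K.vec + b • L.vec + c • M.vec) M.vec = a + b := by
  simp only [Pauli.qubitForm_add_left, Pauli.qubitForm_smul_left, Pauli.qubitForm_self,
    Pauli.qubitForm_vec_of_ne hKL, Pauli.qubitForm_vec_of_ne hKM, Pauli.qubitForm_vec_of_ne hLM,
    Pauli.qubitForm_vec_of_ne hKL.symm, Pauli.qubitForm_vec_of_ne hKM.symm,
    Pauli.qubitForm_vec_of_ne hLM.symm, mul_one, mul_zero, add_zero, zero_add, and_self]

theorem LinearMap.apply_mem_of_forall_single {ι R P : Type*} [Fintype ι] [DecidableEq ι]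
    [Semiring R] [AddCommMonoid P] [Module R P] {N : Submodule R P} (f : (ι → R) →ₗ[R] P)
    (h : ∀ i, f (Pi.single i 1) ∈ N) (w : ι → R) : f w ∈ N := by
  rw [f.pi_apply_eq_sum_univ w]
  refine N.sum_mem fun i _ => N.smul_mem _ ?_
  convert h i using 2
  funext j
  simp [Pi.single_apply, eq_comm]

namespace SurfaceMap

open Pauli

variable {Φ : Type*} {M : SurfaceMap Φ}

theorem exists_eq_innerVertex (ε : {ε : M.medialColex.Edge 1 //
    ∃ w, M.medialColex.face 0 w ∈ M.vertexFaces ∧ M.medialColex.edge 1 w = ε}) :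
    ∃ x, M.innerVertex x = Sum.inr ε := by
  rcases eq_colexVertex_or_eq_innerVertex (Sum.inr ε : M.MedialHVertex) with ⟨t, x, h⟩ | ⟨x, h⟩
  · exact absurd h Sum.inr_ne_inl
  · exact ⟨x, h.symm⟩

/-- The function on the vertices of the hypergraph with the values `p t x` at the vertices of the
2-colex, and `q x` at the inner vertices, provided that `q` takes the same value on the two flags of
each half-edge. -/
noncomputable def glue {A : Type*} (p : Bool → Φ → A) (q : Φ → A) : M.MedialHVertex → A
  | Sum.inl w => p w.2 w.1
  | Sum.inr ε => q (exists_eq_innerVertex ε).choose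

theorem glue_innerVertex {A : Type*} (p : Bool → Φ → A) {q : Φ → A}
    (hq : ∀ x, q (M.α 2 x) = q x) (x : Φ) : glue p q (M.innerVertex x) = q x := by
  have h := (exists_eq_innerVertex (M := M)
    ⟨M.medialColex.edge 1 (x, true), (x, true), ⟨x, rfl⟩, rfl⟩).choose_spec
  change q _ = q x
  rcases innerVertex_eq_iff.1 (h : M.innerVertex _ = M.innerVertex x) with h | h
  · rw [h]
  · rw [h, hq]

/-- The function on pairs of flags that is given by an invariant function on flags.  It is defined by
choosing a flag of each pair, which makes it linear in `f`. -/
noncomputable def descend (i : Fin 3) (f : Φ → ZMod 2) : M.FlagPair i → ZMod 2 :=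
  fun j => f j.out

theorem descend_flagPair {i : Fin 3} {f : Φ → ZMod 2} (hf : ∀ x, f (M.α i x) = f x) (x : Φ) :
    descend i f (M.flagPair i x) = f x := by
  rcases flagPair_eq_iff.1 (Quot.out_eq (M.flagPair i x) : M.flagPair i _ = _) with h | h
  · rw [descend, h]
  · rw [descend, h, hf]

variable (M) in
/-- The coefficients of the generators of the gauge group: of the link edges, of the operators
`Z_u Z_w` with `u` a vertex of the 2-colex and `w` the inner vertex of its rank-3 edge, of the
corner edges on the two sides, of the inner edges, and of the edges along the sides. -/
abbrev Coeff : Type _ := (Φ → ZMod 2) × (Φ → ZMod 2) × (M.FlagPair 1 → ZMod 2) ×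
  (M.FlagPair 1 → ZMod 2) × (M.FlagPair 1 → ZMod 2) × (M.FlagPair 0 → ZMod 2)

namespace Coeff

/-- The coefficient of the link edge of `x`. -/
@[simp] def link (a : M.Coeff) (x : Φ) : ZMod 2 := a.1 x

/-- The coefficient of the operator `Z_u Z_w` with `u` the vertex side of `x` and `w` the inner vertex
of `x`. -/
@[simp] def promoted (a : M.Coeff) (x : Φ) : ZMod 2 := a.2.1 x

/-- The coefficient of the corner edge of `x` on a given side. -/
@[simp] def corner (a : M.Coeff) : Bool → Φ → ZMod 2
  | true, x => a.2.2.1 (M.flagPair 1 x)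
  | false, x => a.2.2.2.1 (M.flagPair 1 x)

/-- The coefficient of the inner edge of `x`. -/
@[simp] def inner (a : M.Coeff) (x : Φ) : ZMod 2 := a.2.2.2.2.1 (M.flagPair 1 x)

/-- The coefficient of the side edge of `x`. -/
@[simp] def side (a : M.Coeff) (x : Φ) : ZMod 2 := a.2.2.2.2.2 (M.flagPair 0 x)

end Coeff

/-- The product, modulo phases, of generators of the gauge group. -/
noncomputable def gaugeMap (c : Set M.MedialHVertex → PauliLetter) :
    M.Coeff →ₗ[ZMod 2] (M.MedialHVertex → ZMod 2 × ZMod 2) where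
  toFun a := glue
    (fun t x => a.link x • (c (M.linkEdge x)).vec + a.corner t x • (c (M.cornerEdge t x)).vec +
      bif t then a.promoted x • PauliLetter.Z.vec else a.side x • (c (M.sideEdge x)).vec)
    (fun x => a.inner x • (c (M.innerEdge x)).vec +
      a.inner (M.α 2 x) • (c (M.innerEdge (M.α 2 x))).vec +
      (a.promoted x + a.promoted (M.α 2 x)) • PauliLetter.Z.vec)
  map_add' a b := by
    funext v
    rcases v with ⟨x, t⟩ | ε
    · cases t <;> simp [glue, add_smul] <;> abel
    · simp [glue, add_smul]
      abel
  map_smul' s a := by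
    funext v
    rcases v with ⟨x, t⟩ | ε
    · cases t <;> simp [glue, mul_smul, smul_add]
    · simp [glue, mul_smul, smul_add, add_smul]

variable {c : Set M.MedialHVertex → PauliLetter} (a : M.Coeff)

theorem gaugeMap_true (x : Φ) : gaugeMap c a (M.colexVertex true x) =
    a.link x • (c (M.linkEdge x)).vec + a.corner true x • (c (M.cornerEdge true x)).vec +
      a.promoted x • PauliLetter.Z.vec := rfl

theorem gaugeMap_false (x : Φ) : gaugeMap c a (M.colexVertex false x) =
    a.link x • (c (M.linkEdge x)).vec + a.corner false x • (c (M.cornerEdge false x)).vec +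
      a.side x • (c (M.sideEdge x)).vec := rfl

theorem gaugeMap_inner (x : Φ) : gaugeMap c a (M.innerVertex x) =
    a.inner x • (c (M.innerEdge x)).vec +
      a.inner (M.α 2 x) • (c (M.innerEdge (M.α 2 x))).vec +
      (a.promoted x + a.promoted (M.α 2 x)) • PauliLetter.Z.vec := by
  rw [gaugeMap, LinearMap.coe_mk, AddHom.coe_mk, glue_innerVertex]
  intro x
  simp only [α_α]
  rw [add_comm (a.inner (M.α 2 x) • _), add_comm (a.promoted (M.α 2 x))]

theorem gaugeMap_ext {p : M.MedialHVertex → ZMod 2 × ZMod 2}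
    (h1 : ∀ x, gaugeMap c a (M.colexVertex true x) = p (M.colexVertex true x))
    (h2 : ∀ x, gaugeMap c a (M.colexVertex false x) = p (M.colexVertex false x))
    (h3 : ∀ x, gaugeMap c a (M.innerVertex x) = p (M.innerVertex x)) : gaugeMap c a = p := by
  funext v
  rcases eq_colexVertex_or_eq_innerVertex v with ⟨t, x, rfl⟩ | ⟨x, rfl⟩
  · cases t
    · exact h2 x
    · exact h1 x
  · exact h3 x

section Single

open Classical in
theorem gaugeMap_link_single (x : Φ) : gaugeMap c (Pi.single x 1, 0, 0, 0, 0, 0) =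
    site (M.colexVertex true x) (c (M.linkEdge x)).vec +
      site (M.colexVertex false x) (c (M.linkEdge x)).vec := by
  refine gaugeMap_ext _ (fun z => ?_) (fun z => ?_) fun z => ?_
  · rw [gaugeMap_true]
    by_cases h : z = x <;> simp [site_apply, colexVertex_inj, h]
  · rw [gaugeMap_false]
    by_cases h : z = x <;> simp [site_apply, colexVertex_inj, h]
  · rw [gaugeMap_inner]
    simp [site_apply, innerVertex_ne_colexVertex]

open Classical in
theorem gaugeMap_promoted_single (x : Φ) : gaugeMap c (0, Pi.single x 1, 0, 0, 0, 0) =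
    site (M.colexVertex true x) PauliLetter.Z.vec + site (M.innerVertex x) PauliLetter.Z.vec := by
  refine gaugeMap_ext _ (fun z => ?_) (fun z => ?_) fun z => ?_
  · rw [gaugeMap_true]
    by_cases h : z = x <;> simp [site_apply, colexVertex_inj, colexVertex_ne_innerVertex, h]
  · rw [gaugeMap_false]
    simp [site_apply, colexVertex_inj, colexVertex_ne_innerVertex]
  · rw [gaugeMap_inner]
    by_cases h : z = x
    · subst h
      simp [site_apply, innerVertex_ne_colexVertex, M.no_fixed 2 z]
    · by_cases h2 : z = M.α 2 x
      · subst h2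
        simp [site_apply, innerVertex_ne_colexVertex, M.no_fixed 2 x]
      · have h3 : M.α 2 z ≠ x := by rintro rfl; simp at h2
        simp [site_apply, innerVertex_ne_colexVertex, innerVertex_eq_iff, h, h2, h3]

open Classical in
theorem gaugeMap_corner_true_single (x : Φ) :
    gaugeMap c (0, 0, Pi.single (M.flagPair 1 x) 1, 0, 0, 0) =
    site (M.colexVertex true x) (c (M.cornerEdge true x)).vec +
      site (M.colexVertex true (M.α 1 x)) (c (M.cornerEdge true x)).vec := by
  refine gaugeMap_ext _ (fun z => ?_) (fun z => ?_) fun z => ?_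
  · rw [gaugeMap_true]
    by_cases h : z = x
    · subst h
      simp [site_apply, colexVertex_inj, (M.no_fixed 1 z).symm]
    · by_cases h2 : z = M.α 1 x
      · subst h2
        simp [site_apply, colexVertex_inj, M.no_fixed 1 x, cornerEdge_α_one]
      · simp [site_apply, colexVertex_inj, h, h2, flagPair_eq_iff]
  · rw [gaugeMap_false]
    simp [site_apply, colexVertex_inj]
  · rw [gaugeMap_inner]
    simp [site_apply, innerVertex_ne_colexVertex]

open Classical in
theorem gaugeMap_corner_false_single (x : Φ) :
    gaugeMap c (0, 0, 0, Pi.single (M.flagPair 1 x) 1, 0, 0) =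
    site (M.colexVertex false x) (c (M.cornerEdge false x)).vec +
      site (M.colexVertex false (M.α 1 x)) (c (M.cornerEdge false x)).vec := by
  refine gaugeMap_ext _ (fun z => ?_) (fun z => ?_) fun z => ?_
  · rw [gaugeMap_true]
    simp [site_apply, colexVertex_inj]
  · rw [gaugeMap_false]
    by_cases h : z = x
    · subst h
      simp [site_apply, colexVertex_inj, (M.no_fixed 1 z).symm]
    · by_cases h2 : z = M.α 1 x
      · subst h2
        simp [site_apply, colexVertex_inj, M.no_fixed 1 x, cornerEdge_α_one]
      · simp [site_apply, colexVertex_inj, h, h2, flagPair_eq_iff]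
  · rw [gaugeMap_inner]
    simp [site_apply, innerVertex_ne_colexVertex]

open Classical in
theorem gaugeMap_inner_single (hdeg : ∀ v : M.Vertex, 2 < M.degree v) (x : Φ) :
    gaugeMap c (0, 0, 0, 0, Pi.single (M.flagPair 1 x) 1, 0) =
    site (M.innerVertex x) (c (M.innerEdge x)).vec +
      site (M.innerVertex (M.α 1 x)) (c (M.innerEdge x)).vec := by
  refine gaugeMap_ext _ (fun z => ?_) (fun z => ?_) fun z => ?_
  · rw [gaugeMap_true]
    simp [site_apply, colexVertex_ne_innerVertex]
  · rw [gaugeMap_false]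
    simp [site_apply, colexVertex_ne_innerVertex]
  · rw [gaugeMap_inner]
    have h1 := M.no_fixed 1
    have h2 := M.no_fixed 2
    have h12 := α_one_ne_α_two hdeg x
    have hsw : ∀ z y, M.α 2 z = y ↔ z = M.α 2 y := by
      intro z y
      constructor <;> rintro rfl <;> simp
    have h21 : M.α 2 (M.α 1 x) ≠ x := fun h => h12 ((hsw _ _).1 h)
    have hinj : ∀ z, M.α 2 z ≠ M.α 2 (M.α 1 z) := fun z h => h1 z ((M.involutive 2).injective h).symm
    simp only [site_apply, Pi.add_apply, Pi.single_apply, flagPair_eq_iff, innerVertex_eq_iff,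
      Coeff.inner, Coeff.promoted]
    by_cases e1 : z = x
    · subst e1
      simp [(h1 z).symm, (h2 z).symm, h2, h12.symm, h21.symm]
    · by_cases e2 : z = M.α 2 x
      · subst e2
        simp [(h1 x).symm, h2, h12.symm, hinj]
      · by_cases e3 : z = M.α 1 x
        · subst e3
          simp [h1, h2, h12, h21, (h2 (M.α 1 x)).symm, innerEdge_α_one]
        · by_cases e4 : z = M.α 2 (M.α 1 x)
          · subst e4
            simp [h1, h2, h21, (hinj x).symm, innerEdge_α_one]
          · simp [e1, e2, e3, e4, hsw]

open Classical in
theorem gaugeMap_side_single (x : Φ) :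
    gaugeMap c (0, 0, 0, 0, 0, Pi.single (M.flagPair 0 x) 1) =
    site (M.colexVertex false x) (c (M.sideEdge x)).vec +
      site (M.colexVertex false (M.α 0 x)) (c (M.sideEdge x)).vec := by
  refine gaugeMap_ext _ (fun z => ?_) (fun z => ?_) fun z => ?_
  · rw [gaugeMap_true]
    simp [site_apply, colexVertex_inj]
  · rw [gaugeMap_false]
    by_cases h : z = x
    · subst h
      simp [site_apply, colexVertex_inj, (M.no_fixed 0 z).symm]
    · by_cases h2 : z = M.α 0 x
      · subst h2
        simp [site_apply, colexVertex_inj, M.no_fixed 0 x, sideEdge_α_zero]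
      · simp [site_apply, colexVertex_inj, h, h2, flagPair_eq_iff]
  · rw [gaugeMap_inner]
    simp [site_apply, innerVertex_ne_colexVertex]

end Single

/-- The operators of the gauge group are the products of the chosen generators. -/
theorem range_gaugeMap [Finite Φ] (hdeg : ∀ v : M.Vertex, 2 < M.degree v)
    (hc : M.medialHypergraph.IsEdgeColoring c) :
    LinearMap.range (gaugeMap c) = M.medialHypergraph.gaugeSpace c := by
  classical
  have := Fintype.ofFinite Φ
  apply le_antisymm
  · rintro _ ⟨⟨a0, z, a1, a2, a3, a4⟩, rfl⟩
    have hsplit : ((a0, z, a1, a2, a3, a4) : M.Coeff) =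
        (a0, 0, 0, 0, 0, 0) + (0, z, 0, 0, 0, 0) + (0, 0, a1, 0, 0, 0) + (0, 0, 0, a2, 0, 0) +
          (0, 0, 0, 0, a3, 0) + (0, 0, 0, 0, 0, a4) := by simp
    rw [hsplit]
    simp only [map_add]
    refine add_mem (add_mem (add_mem (add_mem (add_mem ?_ ?_) ?_) ?_) ?_) ?_
    · refine LinearMap.apply_mem_of_forall_single
        (gaugeMap c ∘ₗ LinearMap.inl _ _ _) (fun x => ?_) a0
      change gaugeMap c (Pi.single x 1, 0, 0, 0, 0, 0) ∈ _
      rw [gaugeMap_link_single]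
      exact Hypergraph.site_add_site_mem_gaugeSpace (linkEdge_mem x) (by simp [linkEdge])
        (by simp [linkEdge])
    · refine LinearMap.apply_mem_of_forall_single
        (gaugeMap c ∘ₗ LinearMap.inr _ _ _ ∘ₗ LinearMap.inl _ _ _) (fun x => ?_) z
      change gaugeMap c (0, Pi.single x 1, 0, 0, 0, 0) ∈ _
      rw [gaugeMap_promoted_single, ← color_promotedEdge hc x]
      exact Hypergraph.site_add_site_mem_gaugeSpace (promotedEdge_mem x) (by simp [promotedEdge])
        (by simp [promotedEdge])
    · refine LinearMap.apply_mem_of_forall_single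
        (gaugeMap c ∘ₗ LinearMap.inr _ _ _ ∘ₗ LinearMap.inr _ _ _ ∘ₗ LinearMap.inl _ _ _)
        (Quot.ind fun x => ?_) a1
      change gaugeMap c (0, 0, Pi.single (M.flagPair 1 x) 1, 0, 0, 0) ∈ _
      rw [gaugeMap_corner_true_single]
      exact Hypergraph.site_add_site_mem_gaugeSpace (cornerEdge_mem true x)
        (by simp [cornerEdge]) (by simp [cornerEdge])
    · refine LinearMap.apply_mem_of_forall_single
        (gaugeMap c ∘ₗ LinearMap.inr _ _ _ ∘ₗ LinearMap.inr _ _ _ ∘ₗ LinearMap.inr _ _ _ ∘ₗ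
          LinearMap.inl _ _ _) (Quot.ind fun x => ?_) a2
      change gaugeMap c (0, 0, 0, Pi.single (M.flagPair 1 x) 1, 0, 0) ∈ _
      rw [gaugeMap_corner_false_single]
      exact Hypergraph.site_add_site_mem_gaugeSpace (cornerEdge_mem false x)
        (by simp [cornerEdge]) (by simp [cornerEdge])
    · refine LinearMap.apply_mem_of_forall_single
        (gaugeMap c ∘ₗ LinearMap.inr _ _ _ ∘ₗ LinearMap.inr _ _ _ ∘ₗ LinearMap.inr _ _ _ ∘ₗ
          LinearMap.inr _ _ _ ∘ₗ LinearMap.inl _ _ _) (Quot.ind fun x => ?_) a3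
      change gaugeMap c (0, 0, 0, 0, Pi.single (M.flagPair 1 x) 1, 0) ∈ _
      rw [gaugeMap_inner_single hdeg]
      exact Hypergraph.site_add_site_mem_gaugeSpace (innerEdge_mem x)
        (by simp [innerEdge]) (by simp [innerEdge])
    · refine LinearMap.apply_mem_of_forall_single
        (gaugeMap c ∘ₗ LinearMap.inr _ _ _ ∘ₗ LinearMap.inr _ _ _ ∘ₗ LinearMap.inr _ _ _ ∘ₗ
          LinearMap.inr _ _ _ ∘ₗ LinearMap.inr _ _ _) (Quot.ind fun x => ?_) a4
      change gaugeMap c (0, 0, 0, 0, 0, Pi.single (M.flagPair 0 x) 1) ∈ _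
      rw [gaugeMap_side_single]
      exact Hypergraph.site_add_site_mem_gaugeSpace (sideEdge_mem x)
        (by simp [sideEdge]) (by simp [sideEdge])
  · refine Submodule.span_le.2 ?_
    rintro _ ⟨e, he, u, hu, v, hv, rfl⟩
    rw [SetLike.mem_coe]
    rcases mem_edgeSet_medialHypergraph.1 he with
      ⟨z, rfl⟩ | ⟨t, z, rfl⟩ | ⟨z, rfl⟩ | ⟨z, rfl⟩ | ⟨z, rfl⟩
    · exact site_add_site_mem_of_pair (LinearMap.mem_range.2 ⟨_, gaugeMap_link_single z⟩) u hu v hv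
    · cases t
      · exact site_add_site_mem_of_pair
          (LinearMap.mem_range.2 ⟨_, gaugeMap_corner_false_single z⟩) u hu v hv
      · exact site_add_site_mem_of_pair (LinearMap.mem_range.2 ⟨_, gaugeMap_corner_true_single z⟩) u hu v hv
    · exact site_add_site_mem_of_pair (LinearMap.mem_range.2 ⟨_, gaugeMap_side_single z⟩) u hu v hv
    · rw [color_promotedEdge hc]
      refine site_add_site_mem_of_star (n := M.innerVertex z) ?_ u hu v hv
      rintro w (rfl | rfl | rfl)
      · exact ⟨_, gaugeMap_promoted_single z⟩
      · rw [← innerVertex_α_two]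
        exact ⟨_, gaugeMap_promoted_single _⟩
      · rw [add_self_vec]
        exact Submodule.zero_mem _
    · exact site_add_site_mem_of_pair (LinearMap.mem_range.2 ⟨_, gaugeMap_inner_single hdeg z⟩) u hu v hv

/-! ### Relations between the generators -/

theorem gaugeMap_eq_zero_iff (hloop : M.Loopless) (hdeg : ∀ v : M.Vertex, 2 < M.degree v)
    (hc : M.medialHypergraph.IsEdgeColoring c) (a : M.Coeff) : gaugeMap c a = 0 ↔
      ∀ x, (a.link x = a.corner true x ∧ a.corner true x = a.promoted x) ∧
        (a.link x = a.corner false x ∧ a.corner false x = a.side x) ∧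
        (a.inner x = a.inner (M.α 2 x) ∧
          a.inner (M.α 2 x) = a.promoted x + a.promoted (M.α 2 x)) := by
  have ht := fun x => PauliLetter.smul_add_smul_add_smul_eq_zero
    (color_linkEdge_ne_color_cornerEdge hc true x) (color_linkEdge_ne_Z hc x)
    (color_cornerEdge_true_ne_Z hc x) (a := a.link x) (b := a.corner true x) (c := a.promoted x)
  have hf := fun x => PauliLetter.smul_add_smul_add_smul_eq_zero
    (color_linkEdge_ne_color_cornerEdge hc false x) (color_linkEdge_ne_color_sideEdge hc x)
    (color_cornerEdge_ne_color_sideEdge hloop hc x)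
    (a := a.link x) (b := a.corner false x) (c := a.side x)
  have hi := fun x => PauliLetter.smul_add_smul_add_smul_eq_zero
    (color_innerEdge_ne_color_innerEdge_α_two hdeg hc x) (color_innerEdge_ne_Z hc x)
    (color_innerEdge_ne_Z hc _) (a := a.inner x) (b := a.inner (M.α 2 x))
    (c := a.promoted x + a.promoted (M.α 2 x))
  constructor
  · intro h x
    exact ⟨(ht x).1 ((gaugeMap_true a x).symm.trans (congrFun h _)),
      (hf x).1 ((gaugeMap_false a x).symm.trans (congrFun h _)),
      (hi x).1 ((gaugeMap_inner a x).symm.trans (congrFun h _))⟩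
  · intro h
    exact gaugeMap_ext a (fun x => (gaugeMap_true a x).trans ((ht x).2 (h x).1))
      (fun x => (gaugeMap_false a x).trans ((hf x).2 (h x).2.1))
      fun x => (gaugeMap_inner a x).trans ((hi x).2 (h x).2.2)

/-- The coefficients of the relation between the generators that is given by a function `s` on
faces and a constant `t`. -/
noncomputable def relation (s : Φ → ZMod 2) (t : ZMod 2) : M.Coeff :=
  (s, s, descend 1 s, descend 1 s, fun _ => t, descend 0 s)

theorem gaugeMap_relation (hloop : M.Loopless) (hdeg : ∀ v : M.Vertex, 2 < M.degree v)
    (hc : M.medialHypergraph.IsEdgeColoring c) {s : Φ → ZMod 2} {t : ZMod 2}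
    (h0 : ∀ x, s (M.α 0 x) = s x) (h1 : ∀ x, s (M.α 1 x) = s x)
    (h2 : ∀ x, s (M.α 2 x) = s x + t) : gaugeMap c (relation (M := M) s t) = 0 := by
  rw [gaugeMap_eq_zero_iff hloop hdeg hc]
  intro x
  simp only [relation, Coeff.link, Coeff.promoted, Coeff.corner, Coeff.inner, Coeff.side,
    descend_flagPair h0, descend_flagPair h1, h2, and_self, true_and]
  rw [← add_assoc, CharTwo.add_self_eq_zero, zero_add]

theorem dual_isBipartite_iff : M.dual.IsBipartite ↔
    ∃ s : Φ → ZMod 2, (∀ x, s (M.α 0 x) = s x) ∧ (∀ x, s (M.α 1 x) = s x) ∧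
      ∀ x, s (M.α 2 x) = s x + 1 := by
  constructor
  · rintro ⟨f, hf⟩
    refine ⟨fun x => if f (M.dual.cell 0 x) then 1 else 0, fun x => ?_, fun x => ?_, fun x => ?_⟩
    · have : M.dual.cell 0 (M.α 0 x) = M.dual.cell 0 x := cell_α (M := M.dual) (j := 2) (by decide) x
      simp only [this]
    · have : M.dual.cell 0 (M.α 1 x) = M.dual.cell 0 x := cell_α (M := M.dual) (j := 1) (by decide) x
      simp only [this]
    · have h : f (M.dual.cell 0 (M.α 2 x)) ≠ f (M.dual.cell 0 x) := hf x
      revert h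
      beta_reduce
      generalize f (M.dual.cell 0 (M.α 2 x)) = p
      generalize f (M.dual.cell 0 x) = q
      revert p q
      decide
  · rintro ⟨s, h0, h1, h2⟩
    obtain ⟨f, hf⟩ := exists_cell_lift (M := M.dual) (i := 0) (fun x => decide (s x = 1)) (by
      intro j hj x
      have hj' : j = 1 ∨ j = 2 := by revert j; decide
      rcases hj' with rfl | rfl
      · exact congrArg (fun t => decide (t = 1)) (h1 x)
      · exact congrArg (fun t => decide (t = 1)) (h0 x))
    refine ⟨f, fun x => ?_⟩
    rw [hf, hf, show M.dual.α 0 x = M.α 2 x from rfl, h2]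
    generalize s x = t
    revert t
    decide

/-- The product of all generators outside the inner faces is trivial.  There is a second independent
relation exactly if the faces can be 2-coloured. -/
theorem finrank_ker_gaugeMap [Finite Φ] [Nonempty Φ] (hloop : M.Loopless)
    (hdeg : ∀ v : M.Vertex, 2 < M.degree v) (hc : M.medialHypergraph.IsEdgeColoring c) :
    Module.finrank (ZMod 2) (LinearMap.ker (gaugeMap c)) = 1 + M.dualBipartiteDelta := by
  obtain ⟨o⟩ := ‹Nonempty Φ›
  let K := LinearMap.ker (gaugeMap c)
  -- A relation is given by a function `s` on faces and a constant `t`.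
  have hK : ∀ a ∈ K, ∃ (s : Φ → ZMod 2) (t : ZMod 2), (∀ x, s (M.α 0 x) = s x) ∧
      (∀ x, s (M.α 1 x) = s x) ∧ (∀ x, s (M.α 2 x) = s x + t) ∧
      (∀ x, a.link x = s x) ∧ (∀ x, a.inner x = t) ∧ (∀ x, a.promoted x = s x) ∧
      (∀ b x, a.corner b x = s x) ∧ ∀ x, a.side x = s x := by
    intro a ha
    have h := (gaugeMap_eq_zero_iff hloop hdeg hc a).1 ha
    have h0 : ∀ x, a.link (M.α 0 x) = a.link x := fun x => by
      rw [(h x).2.1.1, (h x).2.1.2, (h _).2.1.1, (h _).2.1.2, Coeff.side, Coeff.side, flagPair_α]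
    have h1 : ∀ x, a.link (M.α 1 x) = a.link x := fun x => by
      rw [(h x).1.1, (h _).1.1, Coeff.corner, Coeff.corner, flagPair_α]
    have hz : ∀ x, a.promoted x = a.link x := fun x => by rw [(h x).1.1, (h x).1.2]
    have hin : ∀ x, a.inner x = a.link x + a.link (M.α 2 x) := fun x => by
      rw [(h x).2.2.1, (h x).2.2.2, hz, hz]
    have hconst : ∀ x, a.inner x = a.inner o := by
      intro x
      induction M.connected o x with
      | refl => rfl
      | @tail y z _ hyz ih =>
        obtain ⟨i, rfl⟩ := hyz
        rw [← ih]
        have hi : ∀ i : Fin 3, i = 0 ∨ i = 1 ∨ i = 2 := by decide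
        rcases hi i with rfl | rfl | rfl
        · rw [hin, hin, h0, ← M.comm, h0]
        · rw [Coeff.inner, Coeff.inner, flagPair_α]
        · exact (h y).2.2.1.symm
    refine ⟨a.link, a.inner o, h0, h1, fun x => ?_, fun _ => rfl, hconst, hz, ?_, fun x => ?_⟩
    · rw [← hconst x, hin, ← add_assoc, CharTwo.add_self_eq_zero, zero_add]
    · rintro (_ | _) x
      · exact (h x).2.1.1.symm
      · exact (h x).1.1.symm
    · rw [(h x).2.1.1, (h x).2.1.2]
  have hinj : ∀ a ∈ K, a.link o = 0 → a.inner o = 0 → a = 0 := by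
    rintro a ha hl hi
    obtain ⟨s, t, h0, h1, h2, e1, e2, e3, e4, e5⟩ := hK a ha
    have ht : t = 0 := by rw [← e2 o, hi]
    subst ht
    have hs : ∀ x, s x = 0 := by
      intro x
      induction M.connected o x with
      | refl => rw [← e1, hl]
      | @tail y z _ hyz ih =>
        obtain ⟨i, rfl⟩ := hyz
        have hi : ∀ i : Fin 3, i = 0 ∨ i = 1 ∨ i = 2 := by decide
        rcases hi i with rfl | rfl | rfl
        · rw [h0, ih]
        · rw [h1, ih]
        · rw [h2, ih, add_zero]
    refine Prod.ext (funext fun x => (e1 x).trans (hs x)) <|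
      Prod.ext (funext fun x => (e3 x).trans (hs x)) <|
      Prod.ext (funext <| Quot.ind fun x => (e4 true x).trans (hs x)) <|
      Prod.ext (funext <| Quot.ind fun x => (e4 false x).trans (hs x)) <|
      Prod.ext (funext <| Quot.ind fun x => e2 x) <|
      funext <| Quot.ind fun x => (e5 x).trans (hs x)
  have hall : relation (M := M) (fun _ => 1) 0 ∈ K :=
    gaugeMap_relation hloop hdeg hc (fun _ => rfl) (fun _ => rfl) fun _ => rfl
  rw [dualBipartiteDelta]
  split_ifs with hbip
  · obtain ⟨s, h0, h1, h2⟩ := dual_isBipartite_iff.1 hbip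
    have hcol : relation (M := M) s 1 ∈ K := gaugeMap_relation hloop hdeg hc h0 h1 h2
    let f : K →ₗ[ZMod 2] ZMod 2 × ZMod 2 :=
      { toFun := fun a => (a.1.link o, a.1.inner o)
        map_add' := fun _ _ => rfl
        map_smul' := fun _ _ => rfl }
    have hf : Function.Bijective f := by
      constructor
      · refine (injective_iff_map_eq_zero f).2 fun a ha => Subtype.ext ?_
        exact hinj a a.2 (congrArg Prod.fst ha) (congrArg Prod.snd ha)
      · rintro ⟨p, q⟩
        refine ⟨(p + q * s o) • ⟨_, hall⟩ + q • ⟨_, hcol⟩, ?_⟩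
        rw [map_add, map_smul, map_smul]
        refine Prod.ext ?_ ?_
        · change (p + q * s o) * 1 + q * s o = p
          rw [mul_one, add_assoc, CharTwo.add_self_eq_zero, add_zero]
        · change (p + q * s o) * 0 + q * 1 = q
          rw [mul_zero, mul_one, zero_add]
    rw [(LinearEquiv.ofBijective f hf).finrank_eq, Module.finrank_prod, Module.finrank_self]
  · let f : K →ₗ[ZMod 2] ZMod 2 :=
      { toFun := fun a => a.1.link o
        map_add' := fun _ _ => rfl
        map_smul' := fun _ _ => rfl }
    have hf : Function.Bijective f := by
      constructor
      · refine (injective_iff_map_eq_zero f).2 fun a ha => Subtype.ext ?_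
        refine hinj a a.2 ha ?_
        obtain ⟨s, t, h0, h1, h2, e1, e2, -⟩ := hK a a.2
        have ht : ∀ t : ZMod 2, t = 0 ∨ t = 1 := by decide
        rcases ht t with rfl | rfl
        · exact e2 o
        · exact absurd (dual_isBipartite_iff.2 ⟨s, h0, h1, h2⟩) hbip
      · exact fun p => ⟨p • ⟨_, hall⟩, by rw [map_smul]; exact mul_one p⟩
    rw [(LinearEquiv.ofBijective f hf).finrank_eq, Module.finrank_self]

/-! ### The centre of the gauge group -/

/-- The commutation relations of a product of generators with the generators. -/
theorem gaugeMap_mem_orthogonal_iff [Finite Φ] (hloop : M.Loopless)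
    (hdeg : ∀ v : M.Vertex, 2 < M.degree v)
    (hc : M.medialHypergraph.IsEdgeColoring c) (a : M.Coeff) :
    gaugeMap c a ∈ (form M.MedialHVertex).orthogonal (M.medialHypergraph.gaugeSpace c) ↔ ∀ x,
      a.corner true x + a.promoted x = a.corner false x + a.side x ∧
      a.link x + a.promoted x = a.link (M.α 1 x) + a.promoted (M.α 1 x) ∧
      a.link x + a.side x = a.link (M.α 1 x) + a.side (M.α 1 x) ∧
      a.link x + a.corner false x = a.link (M.α 0 x) + a.corner false (M.α 0 x) ∧
      a.inner (M.α 2 x) + (a.promoted x + a.promoted (M.α 2 x)) =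
        a.inner (M.α 2 (M.α 1 x)) + (a.promoted (M.α 1 x) + a.promoted (M.α 2 (M.α 1 x))) ∧
      a.link x + a.corner true x = a.inner x + a.inner (M.α 2 x) := by
  have ht := fun x => PauliLetter.qubitForm_combination
    (color_linkEdge_ne_color_cornerEdge hc true x) (color_linkEdge_ne_Z hc x)
    (color_cornerEdge_true_ne_Z hc x) (a.link x) (a.corner true x) (a.promoted x)
  have hf := fun x => PauliLetter.qubitForm_combination
    (color_linkEdge_ne_color_cornerEdge hc false x) (color_linkEdge_ne_color_sideEdge hc x)
    (color_cornerEdge_ne_color_sideEdge hloop hc x) (a.link x) (a.corner false x) (a.side x)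
  have hi := fun x => PauliLetter.qubitForm_combination
    (color_innerEdge_ne_color_innerEdge_α_two hdeg hc x) (color_innerEdge_ne_Z hc x)
    (color_innerEdge_ne_Z hc _) (a.inner x) (a.inner (M.α 2 x))
    (a.promoted x + a.promoted (M.α 2 x))
  simp only [← gaugeMap_true, ← gaugeMap_false, ← gaugeMap_inner] at ht hf hi
  have ht2 := fun x => cornerEdge_α_one true x ▸ (ht (M.α 1 x)).2.1
  have hf2 := fun x => cornerEdge_α_one false x ▸ (hf (M.α 1 x)).2.1
  have hf1 := fun x => sideEdge_α_zero x ▸ (hf (M.α 0 x)).2.2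
  have hi1 := fun x => innerEdge_α_one x ▸ (hi (M.α 1 x)).1
  rw [Hypergraph.mem_orthogonal_gaugeSpace]
  constructor
  · intro h x
    have e0 := h _ (linkEdge_mem x) (M.colexVertex true x) (by simp [linkEdge])
      (M.colexVertex false x) (by simp [linkEdge])
    have e2t := h _ (cornerEdge_mem true x) (M.colexVertex true x) (by simp [cornerEdge])
      (M.colexVertex true (M.α 1 x)) (by simp [cornerEdge])
    have e2f := h _ (cornerEdge_mem false x) (M.colexVertex false x) (by simp [cornerEdge])
      (M.colexVertex false (M.α 1 x)) (by simp [cornerEdge])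
    have e1 := h _ (sideEdge_mem x) (M.colexVertex false x) (by simp [sideEdge])
      (M.colexVertex false (M.α 0 x)) (by simp [sideEdge])
    have ein := h _ (innerEdge_mem x) (M.innerVertex x) (by simp [innerEdge])
      (M.innerVertex (M.α 1 x)) (by simp [innerEdge])
    have e3 := h _ (promotedEdge_mem x) (M.colexVertex true x) (by simp [promotedEdge])
      (M.innerVertex x) (by simp [promotedEdge])
    rw [color_promotedEdge hc] at e3
    rw [(ht x).1, (hf x).1] at e0
    rw [(ht x).2.1, ht2] at e2t
    rw [(hf x).2.1, hf2] at e2f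
    rw [(hf x).2.2, hf1] at e1
    rw [(hi x).1, hi1] at ein
    rw [(ht x).2.2, (hi x).2.2] at e3
    exact ⟨e0, e2t, e2f, e1, ein, e3⟩
  · intro h
    have hpair : ∀ {A : Type _} {u v : M.MedialHVertex} (q : M.MedialHVertex → A), q u = q v →
        ∀ w ∈ ({u, v} : Set M.MedialHVertex), ∀ w' ∈ ({u, v} : Set M.MedialHVertex),
          q w = q w' := by
      rintro A u v q huv w (rfl | rfl) w' (rfl | rfl) <;> simp [huv]
    intro e he
    rcases mem_edgeSet_medialHypergraph.1 he with
      ⟨x, rfl⟩ | ⟨t, x, rfl⟩ | ⟨x, rfl⟩ | ⟨x, rfl⟩ | ⟨x, rfl⟩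
    · refine hpair (fun v => qubitForm (gaugeMap c a v) _) ?_
      rw [(ht x).1, (hf x).1]
      exact (h x).1
    · refine hpair (fun v => qubitForm (gaugeMap c a v) _) ?_
      cases t
      · rw [(hf x).2.1, hf2]
        exact (h x).2.2.1
      · rw [(ht x).2.1, ht2]
        exact (h x).2.1
    · refine hpair (fun v => qubitForm (gaugeMap c a v) _) ?_
      rw [(hf x).2.2, hf1]
      exact (h x).2.2.2.1
    · rw [color_promotedEdge hc]
      have h3 : ∀ x, qubitForm (gaugeMap c a (M.colexVertex true x)) PauliLetter.Z.vec =
          qubitForm (gaugeMap c a (M.innerVertex x)) PauliLetter.Z.vec := fun x => by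
        rw [(ht x).2.2, (hi x).2.2]
        exact (h x).2.2.2.2.2
      rintro u (rfl | rfl | rfl) v (rfl | rfl | rfl) <;> simp [h3]
    · refine hpair (fun v => qubitForm (gaugeMap c a v) _) ?_
      rw [(hi x).1, hi1]
      exact (h x).2.2.2.2.1

variable (M) in
/-- The parameters of the centre of the gauge group: two functions on vertices, two functions on
faces and a function on corners. -/
abbrev CentreCoeff : Type _ := (M.Vertex → ZMod 2) × (M.Vertex → ZMod 2) × (M.Face → ZMod 2) ×
  (M.Face → ZMod 2) × (M.FlagPair 1 → ZMod 2)

/-- The parametrization of the products of generators that commute with the gauge group, by functions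
`η`, `u` on vertices, `g`, `μ` on faces and `w` on corners.  With `g'` the value of `g` on the other
side of the edge, the coefficients are `g + g' + μ + w` for the link edges, `g' + η` for the operators
in the rank-3 edges, `w + μ + η` and `w` for the corner edges, `g + η y + u` for the inner edges and
`g' + μ` for the side edges.  The function `y` alternates around each vertex. -/
noncomputable def centreMap (y : Φ → ZMod 2) : M.CentreCoeff →ₗ[ZMod 2] M.Coeff where
  toFun b :=
    (fun x => b.2.2.1 (M.cell 2 x) + b.2.2.1 (M.cell 2 (M.α 2 x)) + b.2.2.2.1 (M.cell 2 x) +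
        b.2.2.2.2 (M.flagPair 1 x),
      fun x => b.2.2.1 (M.cell 2 (M.α 2 x)) + b.1 (M.cell 0 x),
      descend 1 fun x => b.2.2.2.2 (M.flagPair 1 x) + b.2.2.2.1 (M.cell 2 x) + b.1 (M.cell 0 x),
      b.2.2.2.2,
      descend 1 fun x => b.2.2.1 (M.cell 2 x) + b.1 (M.cell 0 x) * y x + b.2.1 (M.cell 0 x),
      descend 0 fun x => b.2.2.1 (M.cell 2 (M.α 2 x)) + b.2.2.2.1 (M.cell 2 x))
  map_add' b b' := by
    refine Prod.ext ?_ <| Prod.ext ?_ <| Prod.ext ?_ <| Prod.ext ?_ <| Prod.ext ?_ ?_ <;>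
      funext i <;> simp [descend] <;> ring
  map_smul' s b := by
    refine Prod.ext ?_ <| Prod.ext ?_ <| Prod.ext ?_ <| Prod.ext ?_ <| Prod.ext ?_ ?_ <;>
      funext i <;> simp [descend] <;> ring

section CentreMap

variable {y : Φ → ZMod 2} (b : M.CentreCoeff) (x : Φ)

theorem link_centreMap : (centreMap y b).link x =
    b.2.2.1 (M.cell 2 x) + b.2.2.1 (M.cell 2 (M.α 2 x)) + b.2.2.2.1 (M.cell 2 x) +
        b.2.2.2.2 (M.flagPair 1 x) := rfl

theorem promoted_centreMap : (centreMap y b).promoted x =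
    b.2.2.1 (M.cell 2 (M.α 2 x)) + b.1 (M.cell 0 x) := rfl

theorem corner_true_centreMap : (centreMap y b).corner true x =
    b.2.2.2.2 (M.flagPair 1 x) + b.2.2.2.1 (M.cell 2 x) + b.1 (M.cell 0 x) := by
  refine descend_flagPair (f := fun x =>
    b.2.2.2.2 (M.flagPair 1 x) + b.2.2.2.1 (M.cell 2 x) + b.1 (M.cell 0 x)) (fun x => ?_) x
  rw [flagPair_α, cell_α (by decide), cell_α (by decide)]

theorem corner_false_centreMap : (centreMap y b).corner false x = b.2.2.2.2 (M.flagPair 1 x) := rfl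

theorem inner_centreMap (hy : ∀ x, y (M.α 1 x) = y x) : (centreMap y b).inner x =
    b.2.2.1 (M.cell 2 x) + b.1 (M.cell 0 x) * y x + b.2.1 (M.cell 0 x) := by
  refine descend_flagPair (f := fun x =>
    b.2.2.1 (M.cell 2 x) + b.1 (M.cell 0 x) * y x + b.2.1 (M.cell 0 x)) (fun x => ?_) x
  rw [hy, cell_α (by decide), cell_α (by decide)]

theorem side_centreMap : (centreMap y b).side x =
    b.2.2.1 (M.cell 2 (M.α 2 x)) + b.2.2.2.1 (M.cell 2 x) := by
  refine descend_flagPair (f := fun x =>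
    b.2.2.1 (M.cell 2 (M.α 2 x)) + b.2.2.2.1 (M.cell 2 x)) (fun x => ?_) x
  rw [← M.comm, cell_α (j := 0) (by decide), cell_α (j := 0) (by decide)]

end CentreMap

theorem centreMap_injective {y : Φ → ZMod 2} (hy : ∀ x, y (M.α 1 x) = y x) :
    Function.Injective (centreMap (M := M) y) := by
  refine (injective_iff_map_eq_zero _).2 fun b hb => ?_
  have hw : ∀ x, _ = (0 : ZMod 2) := fun x =>
    (corner_false_centreMap (y := y) b x).symm.trans
      (congrArg (fun a : M.Coeff => a.corner false x) hb)
  have hl : ∀ x, _ = (0 : ZMod 2) := fun x =>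
    (link_centreMap (y := y) b x).symm.trans (congrArg (fun a : M.Coeff => a.link x) hb)
  have hp : ∀ x, _ = (0 : ZMod 2) := fun x =>
    (promoted_centreMap (y := y) b x).symm.trans (congrArg (fun a : M.Coeff => a.promoted x) hb)
  have hs : ∀ x, _ = (0 : ZMod 2) := fun x =>
    (side_centreMap (y := y) b x).symm.trans (congrArg (fun a : M.Coeff => a.side x) hb)
  have hi : ∀ x, _ = (0 : ZMod 2) := fun x =>
    (inner_centreMap b x hy).symm.trans (congrArg (fun a : M.Coeff => a.inner x) hb)
  have hg : ∀ x, b.2.2.1 (M.cell 2 x) = 0 := fun x => by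
    have := hl x
    rwa [hw, add_zero, add_assoc, hs, add_zero] at this
  have hη : ∀ x, b.1 (M.cell 0 x) = 0 := fun x => by
    have := hp x
    rwa [hg, zero_add] at this
  have hμ : ∀ x, b.2.2.2.1 (M.cell 2 x) = 0 := fun x => by
    have := hs x
    rwa [hg, zero_add] at this
  have hu : ∀ x, b.2.1 (M.cell 0 x) = 0 := fun x => by
    have := hi x
    rwa [hg, hη, zero_mul, zero_add, zero_add] at this
  exact Prod.ext (funext <| Quot.ind hη) <| Prod.ext (funext <| Quot.ind hu) <|
    Prod.ext (funext <| Quot.ind hg) <| Prod.ext (funext <| Quot.ind hμ) <|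
    funext <| Quot.ind hw

/-- The products of generators that commute with the gauge group. -/
theorem range_centreMap [Finite Φ] (hloop : M.Loopless)
    (hdeg : ∀ v : M.Vertex, 2 < M.degree v)
    (hc : M.medialHypergraph.IsEdgeColoring c) {y : Φ → ZMod 2} (hy1 : ∀ x, y (M.α 1 x) = y x)
    (hy2 : ∀ x, y (M.α 2 x) = y x + 1) :
    LinearMap.range (centreMap y) = ((form M.MedialHVertex).orthogonal
      (M.medialHypergraph.gaugeSpace c)).comap (gaugeMap c) := by
  ext a
  rw [Submodule.mem_comap, gaugeMap_mem_orthogonal_iff hloop hdeg hc]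
  constructor
  · rintro ⟨b, rfl⟩ x
    have c0 : ∀ x, M.cell 2 (M.α 2 (M.α 0 x)) = M.cell 2 (M.α 2 x) := fun x => by
      rw [← M.comm, cell_α (by decide)]
    simp only [link_centreMap, promoted_centreMap, corner_true_centreMap, corner_false_centreMap,
      inner_centreMap _ _ hy1, side_centreMap, hy1, hy2, α_α, flagPair_α, c0,
      cell_α (M := M) (i := 0) (j := 1) (by decide), cell_α (M := M) (i := 0) (j := 2) (by decide),
      cell_α (M := M) (i := 2) (j := 0) (by decide), cell_α (M := M) (i := 2) (j := 1) (by decide)]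
    refine ⟨?_, ?_, ?_, ?_, ?_, ?_⟩ <;> grind
  · intro h
    have hc1 : ∀ t x, a.corner t (M.α 1 x) = a.corner t x := fun t x => by
      cases t <;> simp
    have hi1 : ∀ x, a.inner (M.α 1 x) = a.inner x := fun x => by simp
    have hs0 : ∀ x, a.side (M.α 0 x) = a.side x := fun x => by simp
    -- The commutation with the edges of a face makes `g` a function on faces.
    let g : Φ → ZMod 2 := fun x => a.link x + a.side x + a.corner false x
    have hg : ∀ x, g x = a.link x + a.side x + a.corner false x := fun _ => rfl
    have hg' : ∀ x, g x = a.promoted x + a.inner x + a.inner (M.α 2 x) := fun x => by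
      have := h x
      grind
    have hg0 : ∀ x, g (M.α 0 x) = g x := fun x => by
      have := h x
      grind
    have hg1 : ∀ x, g (M.α 1 x) = g x := fun x => by
      have := h x
      grind
    have hg20 : ∀ x, g (M.α 2 (M.α 0 x)) = g (M.α 2 x) := fun x => by rw [← M.comm, hg0]
    -- The rank-3 edges and the inner edges at a vertex make `η` a function on vertices.
    let η : Φ → ZMod 2 := fun x => a.promoted x + g (M.α 2 x)
    have hη : ∀ x, η x = a.promoted x + g (M.α 2 x) := fun _ => rfl
    have hη' : ∀ x, η x = a.promoted x + a.promoted (M.α 2 x) + a.inner x + a.inner (M.α 2 x) :=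
      fun x => by
        rw [hη, hg', α_α]
        ring
    have hη2 : ∀ x, η (M.α 2 x) = η x := fun x => by
      rw [hη', hη', α_α]
      ring
    have hη1 : ∀ x, η (M.α 1 x) = η x := fun x => by
      have := (h x).2.2.2.2.1
      rw [hη', hη', hi1]
      grind
    obtain ⟨bη, hbη⟩ := exists_cell_lift (M := M) (i := 0) η fun j hj => by
      have hj' : j = 1 ∨ j = 2 := by revert j; decide
      rcases hj' with rfl | rfl
      exacts [hη1, hη2]
    obtain ⟨bg, hbg⟩ := exists_cell_lift (M := M) (i := 2) g fun j hj => by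
      have hj' : j = 0 ∨ j = 1 := by revert j; decide
      rcases hj' with rfl | rfl
      exacts [hg0, hg1]
    obtain ⟨bμ, hbμ⟩ := exists_cell_lift (M := M) (i := 2) (fun x => a.side x + g (M.α 2 x))
      fun j hj x => by
        have hj' : j = 0 ∨ j = 1 := by revert j; decide
        rcases hj' with rfl | rfl
        · rw [hs0, hg20]
        · have h1 := (h x).1
          have h2 := (h (M.α 1 x)).1
          have h3 := hη1 x
          rw [hη, hη] at h3
          rw [hc1, hc1] at h2
          grind
    obtain ⟨bu, hbu⟩ := exists_cell_lift (M := M) (i := 0)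
      (fun x => a.inner x + g x + η x * y x) fun j hj x => by
        have hj' : j = 1 ∨ j = 2 := by revert j; decide
        rcases hj' with rfl | rfl
        · rw [hi1, hg1, hη1, hy1]
        · have h1 := hg' x
          have h2 := hη x
          rw [hη2, hy2]
          grind
    refine ⟨(bη, bu, bg, bμ, a.2.2.2.1), ?_⟩
    refine Prod.ext (funext fun x => ?_) <| Prod.ext (funext fun x => ?_) <|
      Prod.ext (funext <| Quot.ind fun x => ?_) <| Prod.ext rfl <|
      Prod.ext (funext <| Quot.ind fun x => ?_) <| funext <| Quot.ind fun x => ?_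
    · refine (link_centreMap _ x).trans (?_ : _ = a.link x)
      have h1 := hg x
      simp only [hbg, hbμ]
      change _ + a.corner false x = _
      grind
    · refine (promoted_centreMap _ x).trans (?_ : _ = a.promoted x)
      have h1 := hη x
      simp only [hbg, hbη]
      grind
    · refine (corner_true_centreMap _ x).trans (?_ : _ = a.corner true x)
      have h1 := hη x
      have h2 := (h x).1
      simp only [hbμ, hbη]
      change a.corner false x + _ + _ = _
      grind
    · refine (inner_centreMap _ x hy1).trans (?_ : _ = a.inner x)
      simp only [hbg, hbη, hbu]
      grind
    · refine (side_centreMap _ x).trans (?_ : _ = a.side x)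
      simp only [hbg, hbμ]
      grind

/-! ### The parameters of the code -/

theorem finrank_coeff [Finite Φ] : Module.finrank (ZMod 2) M.Coeff = 16 * M.numEdges := by
  have := Fintype.ofFinite Φ
  have h := card_flags_eq_four_mul (M := M)
  have h0 := card_flags_eq_two_mul (M := M) 0
  have h1 := card_flags_eq_two_mul (M := M) 1
  simp only [Module.finrank_prod, Module.finrank_fintype_fun_eq_card, ← Nat.card_eq_fintype_card]
  omega

theorem finrank_centreCoeff [Finite Φ] : Module.finrank (ZMod 2) M.CentreCoeff =
    2 * Nat.card M.Vertex + 2 * Nat.card M.Face + 2 * M.numEdges := by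
  have h := card_flags_eq_four_mul (M := M)
  have h1 := card_flags_eq_two_mul (M := M) 1
  simp only [Module.finrank_prod, Module.finrank_fintype_fun_eq_card, ← Nat.card_eq_fintype_card]
  omega

/-- The dimension of the gauge group. -/
theorem finrank_gaugeSpace [Finite Φ] [Nonempty Φ] (hloop : M.Loopless)
    (hdeg : ∀ v : M.Vertex, 2 < M.degree v) (hc : M.medialHypergraph.IsEdgeColoring c) :
    Module.finrank (ZMod 2) (M.medialHypergraph.gaugeSpace c) + (1 + M.dualBipartiteDelta) =
      16 * M.numEdges := by
  rw [← finrank_ker_gaugeMap hloop hdeg hc, ← range_gaugeMap hdeg hc,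
    LinearMap.finrank_range_add_finrank_ker, finrank_coeff]

/-- The dimension of the stabilizer. -/
theorem finrank_gaugeSpace_inf_orthogonal [Finite Φ] [Nonempty Φ] (hloop : M.Loopless)
    (heven : ∀ v : M.Vertex, Even (M.degree v))
    (hdeg : ∀ v : M.Vertex, 2 < M.degree v) (hc : M.medialHypergraph.IsEdgeColoring c) :
    Module.finrank (ZMod 2) ↥(M.medialHypergraph.gaugeSpace c ⊓
        (form M.MedialHVertex).orthogonal (M.medialHypergraph.gaugeSpace c)) +
      (1 + M.dualBipartiteDelta) =
      2 * Nat.card M.Vertex + 2 * Nat.card M.Face + 2 * M.numEdges := by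
  obtain ⟨y, hy1, hy2⟩ := exists_alternating heven
  have hinj := centreMap_injective hy1
  have hrange := range_centreMap hloop hdeg hc hy1 hy2
  have hle : LinearMap.ker (gaugeMap c) ≤ LinearMap.range (centreMap y) := by
    intro a ha
    rw [hrange, Submodule.mem_comap, LinearMap.mem_ker.1 ha]
    exact Submodule.zero_mem _
  have hker : Module.finrank (ZMod 2) (LinearMap.ker (gaugeMap c ∘ₗ centreMap y)) =
      1 + M.dualBipartiteDelta := by
    rw [← finrank_ker_gaugeMap hloop hdeg hc, LinearMap.ker_comp,
      (Submodule.equivMapOfInjective _ hinj _).finrank_eq, Submodule.map_comap_eq,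
      inf_eq_right.2 hle]
  have himg : LinearMap.range (gaugeMap c ∘ₗ centreMap y) = M.medialHypergraph.gaugeSpace c ⊓
        (form M.MedialHVertex).orthogonal (M.medialHypergraph.gaugeSpace c) := by
    rw [LinearMap.range_comp, hrange, Submodule.map_comap_eq, range_gaugeMap hdeg hc]
  rw [← himg, ← hker, LinearMap.finrank_range_add_finrank_ker, finrank_centreCoeff]

end SurfaceMap

theorem theorem4 {Φ : Type*} [Finite Φ] [Nonempty Φ] (M : SurfaceMap Φ) (hloop : M.Loopless)
    (heven : ∀ v : M.Vertex, Even (M.degree v)) (hdeg : ∀ v : M.Vertex, 2 < M.degree v) :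
    (∃ c, M.medialHypergraph.IsEdgeColoring c) ∧
    ∀ c, M.medialHypergraph.IsEdgeColoring c →
      ∃ (k r : ℕ) (d : ℕ∞),
        (k : ℤ) = 1 - M.eulerChar + (M.dualBipartiteDelta : ℤ) ∧
        (r : ℤ) = 6 * (M.numEdges : ℤ) - M.eulerChar ∧
        Pauli.IsSubsystemCode (M.medialHypergraph.gaugeGroup c) (10 * M.numEdges) k r d ∧
        ∀ σ : Finset (Set M.MedialHVertex), M.medialHypergraph.IsHypercycle σ →
          cycleOperator c σ ∉ Pauli.stabilizer (M.medialHypergraph.gaugeGroup c) →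
          d ≤ (numRankThree σ : ℕ∞) := by
  refine ⟨SurfaceMap.exists_isEdgeColoring hloop heven hdeg, fun c hc => ?_⟩
  have hrank := fun e (he : e ∈ M.medialHypergraph.edgeSet) =>
    SurfaceMap.ncard_eq_two_or_three hdeg he
  have hcard := SurfaceMap.card_medialHVertex (M := M)
  have hG := SurfaceMap.finrank_gaugeSpace hloop hdeg hc
  have hS := SurfaceMap.finrank_gaugeSpace_inf_orthogonal hloop heven hdeg hc
  have hchi : M.eulerChar =
      (Nat.card M.Vertex : ℤ) - (M.numEdges : ℤ) + (Nat.card M.Face : ℤ) := rfl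
  set N := M.medialHypergraph.gaugeSpace c with hN
  have hle1 := Submodule.finrank_mono
    (inf_le_left : N ⊓ (Pauli.form M.MedialHVertex).orthogonal N ≤ N)
  have hle2 := Submodule.finrank_mono
    (inf_le_right : N ⊓ (Pauli.form M.MedialHVertex).orthogonal N ≤
      (Pauli.form M.MedialHVertex).orthogonal N)
  have hdim : Module.finrank (ZMod 2) (M.MedialHVertex → ZMod 2 × ZMod 2) = 20 * M.numEdges := by
    rw [Module.finrank_pi_fintype]
    simp only [Module.finrank_prod, Module.finrank_self, Finset.sum_const, Finset.card_univ,
      ← Nat.card_eq_fintype_card, hcard, smul_eq_mul]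
    ring
  rw [LinearMap.BilinForm.finrank_orthogonal Pauli.nondegenerate_form, hdim] at hle2
  have hNle := Submodule.finrank_le N
  rw [hdim] at hNle
  refine ⟨M.numEdges + (1 + M.dualBipartiteDelta) - (Nat.card M.Vertex + Nat.card M.Face),
    7 * M.numEdges - (Nat.card M.Vertex + Nat.card M.Face),
    Pauli.distance (M.medialHypergraph.gaugeGroup c), by omega, by omega, ?_, fun σ hσ hS =>
    Hypergraph.distance_le_numRankThree hrank hc hσ hS⟩
  rw [Hypergraph.gaugeGroup_eq_ofSubspace hrank hc]
  exact Pauli.isSubsystemCode_ofSubspace N hcard.symm rfl (by omega) (by omega)
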